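/- **Loop freedom of AODV.** Let the routing protocol AODV be specified in the process algebra AWN as below. Let $N$ be any network expression that is reachable, by transitions of the operational semantics of AWN, from an initial network of finitely many AODV nodes with pairwise different addresses and arbitrary transmission ranges. For each destination $dip$, let the routing graph $\mathcal R_N(dip)$ have the nodes of $N$ as vertices, and an arc $(ip,ip')$ iff $ip\neq dip$ and the current routing table of $ip$ in $N$ contains a valid entry for $dip$ with next hop $ip'$. Then no $\mathcal R_N(dip)$ contains a directed cycle (a self-loop counts as a cycle); that is, this specification of AODV is loop free. This holds for both versions of the topology rules and for both versions of the update of routing tables described below. *AWN.* A sequential process consists of a partial valuation $\xi$ of typed data variables and an expression built from: calls $X(exp_1,\dots,exp_n)$, which continue as the body of the defining equation of $X$ under the valuation $\emptyset[var_i:=\xi(exp_i)]$; guards $[\varphi]p$, which perform $\tau$ and extend $\xi$ by values of the unbound free variables of $\varphi$ such that $\varphi$ holds; assignments $[\![var:=exp]\!]p$ (a $\tau$-step); choice $p+q$; $\mathbf{broadcast}(m).p$; $\mathbf{groupcast}(D,m).p$; $\mathbf{unicast}(d,m).p\blacktriangleright q$ (continue as $p$ on success, as $q$ on failure); $\mathbf{send}(m).p$;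 $\mathbf{deliver}(data).p$; $\mathbf{receive}(msg).p$. An undefined expression blocks; a formula with an undefined subexpression does not hold. In $P\langle\!\langle Q$ a $\mathbf{receive}(m)$ of $P$ synchronises with a $\mathbf{send}(m)$ of $Q$ to $\tau$ (neither occurs separately), and all other actions are interleaved. A node $ip:P:R$ has an address $ip$, a process $P$ and a range $R$, a set of addresses. A broadcast is received by all other nodes in $R$, a groupcast to $D$ by all other nodes in $R\cap D$, a unicast to $d\in R$ by $d$ (if it is a different node of the network); a unicast to $d\notin R$ fails. A message arriving at a node has to be received by it. A client may at any time submit to one node a message $\mathsf{newpkt}(data,dip)$. At any time $\mathbf{connect}(ip,ip')$ and $\mathbf{disconnect}(ip,ip')$ may change ranges; in the first version they add $ip'$ to, or remove it from, the range of $ip$ only; in the second (symmetric) version they also add $ip$ to, or remove it from, the range of $ip'$. *Data.* Sequence numbers are natural numbers, $0$ meaning unknown; $\mathsf{inc}(0)=0$ and $\mathsf{inc}(n)=n+1$ for $n>0$. A routing table $rt$ is a set of entries $(dip,dsn,dsk,flag,hops,nhip,pre)$, at most one per destination $dip$: sequence number, its status ($\mathsf{kno}/\mathsf{unk}$), validity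 ($\mathsf{val}/\mathsf{inv}$), hop count, next hop, set of precursors. $\mathsf{sqn},\mathsf{sqnf},\mathsf{dhops},\mathsf{nhop},\mathsf{precs}(rt,dip)$ are the components of the entry for $dip$ (if there is none, $\mathsf{sqn}=0$, $\mathsf{sqnf}=\mathsf{unk}$, the others are undefined). $\mathsf{kD}(rt)$ and $\mathsf{vD}(rt)$ are the sets of destinations with an entry and with a valid entry. $\mathsf{addpre}(rt,dip,A)$ adds $A$ to the precursors of the entry for $dip$ (undefined without an entry). $\mathsf{update}(rt,r)$ adds $r=(dip,dsn,dsk,flag,hops,nhip,pre)$ if $dip\notin\mathsf{kD}(rt)$. If there is an entry $s$ for $dip$, it is replaced by $r$ if $dsn_s<dsn$, or if $dsn_s=dsn$ and $s$ is invalid or has a hop count $>hops$; otherwise it is kept; in either case the precursors of both are united. This is the first version of the update; in the second version, if $r$ does not replace $s$ by this rule but has $dsk=\mathsf{unk}$, then $s$ is replaced by $r$ with the sequence number of $s$. For a partial function $dests$ from addresses to sequence numbers, $\mathsf{invalidate}(rt,dests)$ sets the flag to $\mathsf{inv}$ and the sequence number to $dests(rip)$ in each entry of $rt$ for a destination $rip$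 in the domain of $dests$. A store $queues$ holds, for each of a set $\mathsf{qD}(queues)$ of destinations, a flag $\mathsf{pen}/\mathsf{nonpen}$ (a route request is pending or not) and a queue of data packets; $\mathsf{setP}(queues,dip,f)$ sets the flag for $dip$; a new queue has the flag $\mathsf{nonpen}$; dropping the last packet of a queue removes it. A message is $\mathsf{newpkt}(data,dip)$, $\mathsf{pkt}(data,dip,oip)$, $\mathsf{rreq}(hops,rreqid,dip,dsn,dsk,oip,osn,sip)$, $\mathsf{rrep}(hops,dip,dsn,oip,sip)$ or $\mathsf{rerr}(dests,sip)$. *Processes.* Each node runs $\mathsf{AODV}(ip,rt,sn,rreqs,queues)\langle\!\langle\mathsf{QMSG}(msgs)$; initially $ip$ is its own address, $rt$, $rreqs$, $queues$ and $msgs$ are empty, and $sn=1$. $\mathsf{QMSG}$ is a first-in-first-out message queue which can always receive. Every process below returns to $\mathsf{AODV}$ with the current values of $ip,rt,sn,rreqs,queues$. $\mathsf{Report}$ denotes: $rt:=\mathsf{invalidate}(rt,dests)$; set the flags in $queues$ to $\mathsf{nonpen}$ for all destinations in $dests$; $pre:=$ the union of the $\mathsf{precs}(rt,rip)$ over $rip$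 in the domain of $dests$; restrict $dests$ to those $rip$ with $\mathsf{precs}(rt,rip)\neq\emptyset$; groupcast $\mathsf{rerr}(dests,ip)$ to $pre$. $\mathsf{Break}(d)$ denotes: $dests:=\{(rip,\mathsf{inc}(\mathsf{sqn}(rt,rip)))\mid rip\in\mathsf{vD}(rt),\ \mathsf{nhop}(rt,rip)=\mathsf{nhop}(rt,d)\}$; $\mathsf{Report}$. - $\mathsf{AODV}$ does one of the following. (i) It receives a message from its queue and handles it as below; for $\mathsf{rreq}$, $\mathsf{rrep}$, $\mathsf{rerr}$ it first sets $rt:=\mathsf{update}(rt,(sip,0,\mathsf{unk},\mathsf{val},1,sip,\emptyset))$. (ii) For some $dip\in\mathsf{qD}(queues)\cap\mathsf{vD}(rt)$ it unicasts $\mathsf{pkt}(data,dip,ip)$ to $\mathsf{nhop}(rt,dip)$, where $data$ is the first packet queued for $dip$; on success it drops this packet, on failure it performs $\mathsf{Break}(dip)$. (iii) For some $dip\in\mathsf{qD}(queues)\setminus\mathsf{vD}(rt)$ with flag $\mathsf{nonpen}$: set the flag to $\mathsf{pen}$; $sn:=\mathsf{inc}(sn)$; $rreqid:=1+\max\{n\mid(ip,n)\in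 rreqs\}$ (with $\max\emptyset=0$); add $(ip,rreqid)$ to $rreqs$; broadcast $\mathsf{rreq}(0,rreqid,dip,\mathsf{sqn}(rt,dip),\mathsf{sqnf}(rt,dip),ip,sn,ip)$. - $\mathsf{newpkt}(data,dip)$: if $dip=ip$ deliver $data$, otherwise append it to the queue for $dip$. - $\mathsf{pkt}(data,dip,oip)$: if $dip=ip$ deliver $data$. Otherwise, if $dip\in\mathsf{vD}(rt)$, unicast the packet to $\mathsf{nhop}(rt,dip)$, and on failure perform $\mathsf{Break}(dip)$; if $dip\in\mathsf{kD}(rt)\setminus\mathsf{vD}(rt)$, groupcast $\mathsf{rerr}(\{(dip,\mathsf{sqn}(rt,dip))\},ip)$ to $\mathsf{precs}(rt,dip)$; if $dip\notin\mathsf{kD}(rt)$ do nothing. - $\mathsf{rreq}(hops,rreqid,dip,dsn,dsk,oip,osn,sip)$: if $(oip,rreqid)\in rreqs$ do nothing. Otherwise $rt:=\mathsf{update}(rt,(oip,osn,\mathsf{kno},\mathsf{val},hops+1,sip,\emptyset))$ and add $(oip,rreqid)$ to $rreqs$. If $dip=ip$: $sn:=\max(sn,dsn)$; unicast $\mathsf{rrep}(0,dip,sn,oip,ip)$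 to $\mathsf{nhop}(rt,oip)$. If $dip\neq ip$, $dip\in\mathsf{vD}(rt)$, $dsn\le\mathsf{sqn}(rt,dip)$ and $\mathsf{sqnf}(rt,dip)=\mathsf{kno}$: $rt:=\mathsf{addpre}(rt,dip,\{sip\})$; $rt:=\mathsf{addpre}(rt,oip,\{\mathsf{nhop}(rt,dip)\})$; unicast $\mathsf{rrep}(\mathsf{dhops}(rt,dip),dip,\mathsf{sqn}(rt,dip),oip,ip)$ to $\mathsf{nhop}(rt,oip)$. On failure of either unicast perform $\mathsf{Break}(oip)$. In all other cases broadcast $\mathsf{rreq}(hops+1,rreqid,dip,\max(\mathsf{sqn}(rt,dip),dsn),dsk,oip,osn,ip)$. - $\mathsf{rrep}(hops,dip,dsn,oip,sip)$: let $rt'=\mathsf{update}(rt,(dip,dsn,\mathsf{kno},\mathsf{val},hops+1,sip,\emptyset))$. If $rt'=rt$ do nothing. Otherwise $rt:=rt'$. Then, if $oip=ip$, set the flag for $dip$ in $queues$ to $\mathsf{nonpen}$. If $oip\neq ip$ and $oip\in\mathsf{vD}(rt)$: $rt:=\mathsf{addpre}(rt,dip,\{\mathsf{nhop}(rt,oip)\})$;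 $rt:=\mathsf{addpre}(rt,\mathsf{nhop}(rt,dip),\{\mathsf{nhop}(rt,oip)\})$; unicast $\mathsf{rrep}(hops+1,dip,dsn,oip,ip)$ to $\mathsf{nhop}(rt,oip)$; on failure perform $\mathsf{Break}(oip)$. - $\mathsf{rerr}(dests,sip)$: restrict $dests$ to the pairs $(rip,rsn)$ with $rip\in\mathsf{vD}(rt)$, $\mathsf{nhop}(rt,rip)=sip$ and $\mathsf{sqn}(rt,rip)<rsn$; $\mathsf{Report}$. All tests, assignments and transmissions are separate transitions, so transitions of other nodes may occur in between. -/

import Mathlib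

/-! # The process algebra AWN -/

namespace AWN

/-- A valuation: a partial assignment of values (of the right type) to the data variables. -/
abbrev Valuation {Var : Type} (T : Var → Type) : Type := (x : Var) → Option (T x)

/-- A data expression, given by its meaning under each valuation; `none` means that the expression
is not defined (an unbound variable, or a partial operator outside of its domain). -/
abbrev Exp {Var : Type} (T : Var → Type) (α : Type) : Type := Valuation T → Option α

/-- A data formula: its free variables and its truth value under each valuation. -/
structure Formula {Var : Type} (T : Var → Type) where
  fv : List Var
  body : Exp T Prop

section Language

variable {Var : Type} {T : Var → Type} {IP DATA MSG PN : Type}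

/-- A formula that involves an undefined expression does not hold. -/
def Formula.Holds (φ : Formula T) (ξ : Valuation T) : Prop := ∃ P : Prop, φ.body ξ = some P ∧ P

/-- `φ.Extends ξ ζ` is the relation `ξ -φ→ ζ`: the valuation `ζ` agrees with `ξ` wherever `ξ` is
defined, it evaluates in addition exactly the other free variables of `φ`, and `φ` holds
under `ζ`. -/
def Formula.Extends (φ : Formula T) (ξ ζ : Valuation T) : Prop :=
  (∀ x, ξ x ≠ none → ζ x = ξ x) ∧ (∀ x, ξ x = none → (ζ x ≠ none ↔ x ∈ φ.fv)) ∧ φ.Holds ζ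

/-- `bindArgs ξ [(x₁, e₁), …, (xₙ, eₙ)]` is the valuation `∅[xᵢ := ξ(eᵢ)]`, provided all `ξ(eᵢ)` are
defined. -/
def bindArgs [DecidableEq Var] (ξ : Valuation T) :
    List ((x : Var) × Exp T (T x)) → Option (Valuation T)
  | [] => some fun _ => none
  | ⟨x, e⟩ :: l => do
      let a ← e ξ
      let ζ ← bindArgs ξ l
      some (Function.update ζ x (some a))

/-- Sequential process expressions. In `call X args` the list `args` pairs each parameter of `X`
with the argument passed for it. -/
inductive SP (Var : Type) (T : Var → Type) (IP DATA MSG PN : Type) : Type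
  | call (X : PN) (args : List ((x : Var) × Exp T (T x)))
  | guard (φ : Formula T) (p : SP Var T IP DATA MSG PN)
  | assign (x : Var) (e : Exp T (T x)) (p : SP Var T IP DATA MSG PN)
  | choice (p q : SP Var T IP DATA MSG PN)
  | broadcast (ms : Exp T MSG) (p : SP Var T IP DATA MSG PN)
  | groupcast (dests : Exp T (Set IP)) (ms : Exp T MSG) (p : SP Var T IP DATA MSG PN)
  | unicast (dest : Exp T IP) (ms : Exp T MSG) (p q : SP Var T IP DATA MSG PN)
  | send (ms : Exp T MSG) (p : SP Var T IP DATA MSG PN)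
  | deliver (data : Exp T DATA) (p : SP Var T IP DATA MSG PN)
  | receive (x : Var) (h : MSG = T x) (p : SP Var T IP DATA MSG PN)

/-- Actions of sequential and parallel processes. -/
inductive Act (IP DATA MSG : Type) : Type
  | broadcast (m : MSG)
  | groupcast (D : Set IP) (m : MSG)
  | unicast (dip : IP) (m : MSG)
  | notUnicast (dip : IP)
  | send (m : MSG)
  | deliver (d : DATA)
  | receive (m : MSG)
  | tau

/-- Structural operational semantics of sequential process expressions, where `Γ` gives the bodies
of the defining equations. There is no transition if an expression that has to be evaluated is
undefined. -/
inductive SeqStep [DecidableEq Var] (Γ : PN → SP Var T IP DATA MSG PN) :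
    Valuation T → SP Var T IP DATA MSG PN → Act IP DATA MSG →
    Valuation T → SP Var T IP DATA MSG PN → Prop
  | broadcast {ξ ms p m} (hm : ms ξ = some m) :
      SeqStep Γ ξ (.broadcast ms p) (.broadcast m) ξ p
  | groupcast {ξ dests ms p D m} (hD : dests ξ = some D) (hm : ms ξ = some m) :
      SeqStep Γ ξ (.groupcast dests ms p) (.groupcast D m) ξ p
  | unicast {ξ dest ms p q dip m} (hd : dest ξ = some dip) (hm : ms ξ = some m) :
      SeqStep Γ ξ (.unicast dest ms p q) (.unicast dip m) ξ p
  | notUnicast {ξ dest ms p q dip} (hd : dest ξ = some dip) :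
      SeqStep Γ ξ (.unicast dest ms p q) (.notUnicast dip) ξ q
  | send {ξ ms p m} (hm : ms ξ = some m) :
      SeqStep Γ ξ (.send ms p) (.send m) ξ p
  | deliver {ξ data p d} (hd : data ξ = some d) :
      SeqStep Γ ξ (.deliver data p) (.deliver d) ξ p
  | receive {ξ x p} (h : MSG = T x) (m : MSG) :
      SeqStep Γ ξ (.receive x h p) (.receive m) (Function.update ξ x (some (cast h m))) p
  | assign {ξ x p} {e : Exp T (T x)} {a} (he : e ξ = some a) :
      SeqStep Γ ξ (.assign x e p) .tau (Function.update ξ x (some a)) p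
  | call {ξ X args ξ' a ζ p'} (hargs : bindArgs ξ args = some ξ')
      (h : SeqStep Γ ξ' (Γ X) a ζ p') : SeqStep Γ ξ (.call X args) a ζ p'
  | choiceLeft {ξ p q a ζ p'} (h : SeqStep Γ ξ p a ζ p') : SeqStep Γ ξ (.choice p q) a ζ p'
  | choiceRight {ξ p q a ζ q'} (h : SeqStep Γ ξ q a ζ q') : SeqStep Γ ξ (.choice p q) a ζ q'
  | guard {ξ ζ p} {φ : Formula T} (h : φ.Extends ξ ζ) : SeqStep Γ ξ (.guard φ p) .tau ζ p

/-- Parallel process expressions: the processes that run on one node. -/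
inductive PP (Var : Type) (T : Var → Type) (IP DATA MSG PN : Type) : Type
  | seq (ξ : Valuation T) (p : SP Var T IP DATA MSG PN)
  | par (P Q : PP Var T IP DATA MSG PN)

/-- Structural operational semantics of parallel process expressions. -/
inductive ParStep [DecidableEq Var] (Γ : PN → SP Var T IP DATA MSG PN) :
    PP Var T IP DATA MSG PN → Act IP DATA MSG → PP Var T IP DATA MSG PN → Prop
  | seq {ξ p a ζ p'} (h : SeqStep Γ ξ p a ζ p') : ParStep Γ (.seq ξ p) a (.seq ζ p')
  | left {P P' Q a} (h : ParStep Γ P a P') (ha : ∀ m, a ≠ .receive m) :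
      ParStep Γ (.par P Q) a (.par P' Q)
  | right {P Q Q' a} (h : ParStep Γ Q a Q') (ha : ∀ m, a ≠ .send m) :
      ParStep Γ (.par P Q) a (.par P Q')
  | comm {P P' Q Q' m} (hP : ParStep Γ P (.receive m) P') (hQ : ParStep Γ Q (.send m) Q') :
      ParStep Γ (.par P Q) .tau (.par P' Q')

/-- Partial networks: parallel compositions of node expressions `ip : P : R`. -/
inductive PNet (Var : Type) (T : Var → Type) (IP DATA MSG PN : Type) : Type
  | node (ip : IP) (P : PP Var T IP DATA MSG PN) (R : Set IP)
  | par (M N : PNet Var T IP DATA MSG PN)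

/-- Network expressions `[M]`. -/
structure Network (Var : Type) (T : Var → Type) (IP DATA MSG PN : Type) : Type where
  encap ::
  body : PNet Var T IP DATA MSG PN

/-- The addresses of the nodes of a partial network. -/
def PNet.addresses : PNet Var T IP DATA MSG PN → Set IP
  | .node ip _ _ => {ip}
  | .par M N => M.addresses ∪ N.addresses

/-- `M.HasNode ip P R`: the node expression `ip : P : R` is a component of `M`. -/
def PNet.HasNode : PNet Var T IP DATA MSG PN → IP → PP Var T IP DATA MSG PN → Set IP → Prop
  | .node ip P R => fun ip' P' R' => ip = ip' ∧ P = P' ∧ R = R'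
  | .par M N => fun ip P R => M.HasNode ip P R ∨ N.HasNode ip P R

/-- Transition labels of node and network expressions. -/
inductive NAct (IP DATA MSG : Type) : Type
  | starcast (R : Set IP) (m : MSG)
  | arrive (H K : Set IP) (m : MSG)
  | connect (ip ip' : IP)
  | disconnect (ip ip' : IP)
  | newpkt (ip : IP) (d : DATA) (dip : IP)
  | deliver (ip : IP) (d : DATA)
  | tau

/-- The labels `connect(ip, ip')` and `disconnect(ip, ip')`. -/
def NAct.IsTopology : NAct IP DATA MSG → Prop
  | .connect _ _ => True
  | .disconnect _ _ => True
  | _ => False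

/-- The labels `ip : deliver(d)` and `τ`. -/
def NAct.IsLocal : NAct IP DATA MSG → Prop
  | .deliver _ _ => True
  | .tau => True
  | _ => False

/-- Structural operational semantics of node expressions and partial networks. With `symm = false`
links are directed: `connect(ip, ip')` only affects the range of `ip`. With `symm = true` the rules
that keep ranges symmetric are used instead. -/
inductive PNetStep [DecidableEq Var] (Γ : PN → SP Var T IP DATA MSG PN) (symm : Bool) :
    PNet Var T IP DATA MSG PN → NAct IP DATA MSG → PNet Var T IP DATA MSG PN → Prop
  | broadcast {ip P P' R m} (h : ParStep Γ P (.broadcast m) P') :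
      PNetStep Γ symm (.node ip P R) (.starcast R m) (.node ip P' R)
  | groupcast {ip P P' R D m} (h : ParStep Γ P (.groupcast D m) P') :
      PNetStep Γ symm (.node ip P R) (.starcast (R ∩ D) m) (.node ip P' R)
  | unicast {ip P P' R dip m} (h : ParStep Γ P (.unicast dip m) P') (hR : dip ∈ R) :
      PNetStep Γ symm (.node ip P R) (.starcast {dip} m) (.node ip P' R)
  | notUnicast {ip P P' R dip} (h : ParStep Γ P (.notUnicast dip) P') (hR : dip ∉ R) :
      PNetStep Γ symm (.node ip P R) .tau (.node ip P' R)
  | deliver {ip P P' R d} (h : ParStep Γ P (.deliver d) P') :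
      PNetStep Γ symm (.node ip P R) (.deliver ip d) (.node ip P' R)
  | receive {ip P P' R m} (h : ParStep Γ P (.receive m) P') :
      PNetStep Γ symm (.node ip P R) (.arrive {ip} ∅ m) (.node ip P' R)
  | tau {ip P P' R} (h : ParStep Γ P .tau P') :
      PNetStep Γ symm (.node ip P R) .tau (.node ip P' R)
  | disregard {ip P R m} :
      PNetStep Γ symm (.node ip P R) (.arrive ∅ {ip} m) (.node ip P R)
  | connect {ip ip' P R} :
      PNetStep Γ symm (.node ip P R) (.connect ip ip') (.node ip P (R ∪ {ip'}))
  | disconnect {ip ip' P R} :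
      PNetStep Γ symm (.node ip P R) (.disconnect ip ip') (.node ip P (R \ {ip'}))
  | connectSymm {ip ip' P R} (hs : symm = true) :
      PNetStep Γ symm (.node ip P R) (.connect ip' ip) (.node ip P (R ∪ {ip'}))
  | disconnectSymm {ip ip' P R} (hs : symm = true) :
      PNetStep Γ symm (.node ip P R) (.disconnect ip' ip) (.node ip P (R \ {ip'}))
  | connectOther {ip ip' ip'' P R} (hs : symm = true) (h' : ip ≠ ip') (h'' : ip ≠ ip'') :
      PNetStep Γ symm (.node ip P R) (.connect ip' ip'') (.node ip P R)
  | disconnectOther {ip ip' ip'' P R} (hs : symm = true) (h' : ip ≠ ip') (h'' : ip ≠ ip'') :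
      PNetStep Γ symm (.node ip P R) (.disconnect ip' ip'') (.node ip P R)
  | castLeft {M M' N N' R H K m} (hM : PNetStep Γ symm M (.starcast R m) M')
      (hN : PNetStep Γ symm N (.arrive H K m) N') (hH : H ⊆ R) (hK : K ∩ R = ∅) :
      PNetStep Γ symm (.par M N) (.starcast R m) (.par M' N')
  | castRight {M M' N N' R H K m} (hM : PNetStep Γ symm M (.starcast R m) M')
      (hN : PNetStep Γ symm N (.arrive H K m) N') (hH : H ⊆ R) (hK : K ∩ R = ∅) :
      PNetStep Γ symm (.par N M) (.starcast R m) (.par N' M')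
  | arrive {M M' N N' H K H' K' m} (hM : PNetStep Γ symm M (.arrive H K m) M')
      (hN : PNetStep Γ symm N (.arrive H' K' m) N') :
      PNetStep Γ symm (.par M N) (.arrive (H ∪ H') (K ∪ K') m) (.par M' N')
  | interleaveLeft {M M' N a} (h : PNetStep Γ symm M a M')
      (ha : a.IsLocal ∨ (symm = false ∧ a.IsTopology)) :
      PNetStep Γ symm (.par M N) a (.par M' N)
  | interleaveRight {M N N' a} (h : PNetStep Γ symm N a N')
      (ha : a.IsLocal ∨ (symm = false ∧ a.IsTopology)) :
      PNetStep Γ symm (.par M N) a (.par M N')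
  | topology {M M' N N' a} (hM : PNetStep Γ symm M a M') (hN : PNetStep Γ symm N a N')
      (hs : symm = true) (ha : a.IsTopology) :
      PNetStep Γ symm (.par M N) a (.par M' N')

/-- Structural operational semantics of encapsulated networks; `newpkt d dip` is the message by
which a client submits the data `d` for the destination `dip`. -/
inductive NetStep [DecidableEq Var] (Γ : PN → SP Var T IP DATA MSG PN) (newpkt : DATA → IP → MSG)
    (symm : Bool) :
    Network Var T IP DATA MSG PN → NAct IP DATA MSG → Network Var T IP DATA MSG PN → Prop
  | starcast {M M' R m} (h : PNetStep Γ symm M (.starcast R m) M') :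
      NetStep Γ newpkt symm (.encap M) .tau (.encap M')
  | newpkt {M M' ip K d dip} (h : PNetStep Γ symm M (.arrive {ip} K (newpkt d dip)) M') :
      NetStep Γ newpkt symm (.encap M) (.newpkt ip d dip) (.encap M')
  | inherit {M M' a} (h : PNetStep Γ symm M a M') (ha : a.IsLocal ∨ a.IsTopology) :
      NetStep Γ newpkt symm (.encap M) a (.encap M')

end Language

end AWN

/-! # The data structure of AODV -/

namespace AODV

/-- Sequence-number-status flag: known or unknown. -/
inductive SqnK : Type
  | kno
  | unk

/-- Validity of a route. -/
inductive Flag : Type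
  | val
  | inv

/-- Pending-request flag: has a route request already been issued (and is it pending)? -/
inductive PFlag : Type
  | pen
  | nonpen

/-- A routing table entry without its destination. -/
structure Entry (IP : Type) where
  dsn : ℕ
  dsk : SqnK
  flag : Flag
  hops : ℕ
  nhip : IP
  pre : Set IP

/-- Routing tables: sets of entries `(dip, dsn, dsk, flag, hops, nhip, pre)` with at most one entry
for each destination `dip`, that is, partial functions of `dip`. -/
abbrev RT (IP : Type) : Type := IP → Option (Entry IP)

/-- Sets of destinations with sequence numbers. -/
abbrev Dests (IP : Type) : Type := IP → Option ℕ

/-- Stores of queued data packets: for each destination at most one entry, which holds a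
pending-request flag and a queue of packets. -/
abbrev Queues (IP DATA : Type) : Type := IP → Option (PFlag × List DATA)

/-- Messages. -/
inductive Msg (IP DATA : Type) : Type
  | newpkt (data : DATA) (dip : IP)
  | pkt (data : DATA) (dip oip : IP)
  | rreq (hops rreqid : ℕ) (dip : IP) (dsn : ℕ) (dsk : SqnK) (oip : IP) (osn : ℕ) (sip : IP)
  | rrep (hops : ℕ) (dip : IP) (dsn : ℕ) (oip sip : IP)
  | rerr (dests : Dests IP) (sip : IP)

section Operators

variable {IP DATA : Type}

/-- Increment of a sequence number; the unknown sequence number 0 stays unknown. -/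
def inc (n : ℕ) : ℕ := if n = 0 then 0 else n + 1

/-- Sequence number of the entry for `dip` (0, unknown, if there is none). -/
def sqn (rt : RT IP) (dip : IP) : ℕ := ((rt dip).map Entry.dsn).getD 0

/-- Sequence-number status of the entry for `dip` (unknown if there is none). -/
def sqnf (rt : RT IP) (dip : IP) : SqnK := ((rt dip).map Entry.dsk).getD .unk

def status (rt : RT IP) (dip : IP) : Option Flag := (rt dip).map Entry.flag

def dhops (rt : RT IP) (dip : IP) : Option ℕ := (rt dip).map Entry.hops

def nhop (rt : RT IP) (dip : IP) : Option IP := (rt dip).map Entry.nhip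

def precs (rt : RT IP) (dip : IP) : Option (Set IP) := (rt dip).map Entry.pre

/-- The known destinations. -/
def kD (rt : RT IP) : Set IP := {dip | rt dip ≠ none}

/-- The destinations to which a valid route is known. -/
def vD (rt : RT IP) : Set IP := {dip | status rt dip = some .val}

/-- Add precursors to an entry. -/
def Entry.addpre (e : Entry IP) (npre : Set IP) : Entry IP := { e with pre := e.pre ∪ npre }

open Classical in
/-- Add precursors to the entry for `dip` in a routing table, if there is one. -/
noncomputable def addpreRT (rt : RT IP) (dip : IP) (npre : Set IP) : Option (RT IP) :=
  (rt dip).map fun e => Function.update rt dip (some (e.addpre npre))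

open Classical in
/-- The new entry for a destination with the existing entry `s`, when a route `r` to that
destination is offered. The entry is overwritten by `r` if `r` is fresher: it has a larger sequence
number, or the same one while the existing entry is invalid or has a larger hop count. In any case
the precursors of both are kept. If `refresh` is true, then a route `r` with an unknown sequence
number is also adopted, with the existing sequence number. -/
noncomputable def mergeEntry (refresh : Bool) (s r : Entry IP) : Entry IP :=
  if s.dsn < r.dsn ∨ (s.dsn = r.dsn ∧ (s.flag = .inv ∨ r.hops < s.hops)) then r.addpre s.pre
  else if refresh = true ∧ r.dsk = .unk then { r.addpre s.pre with dsn := s.dsn }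
  else s.addpre r.pre

open Classical in
/-- Update of a routing table with a route `r` to `dip`. -/
noncomputable def upd (refresh : Bool) (rt : RT IP) (dip : IP) (r : Entry IP) : RT IP :=
  Function.update rt dip <| some <|
    match rt dip with
    | none => r
    | some s => mergeEntry refresh s r

/-- Invalidate the entries for the given destinations, and give them the given sequence numbers. -/
def invalidate (rt : RT IP) (dests : Dests IP) : RT IP := fun rip =>
  match rt rip, dests rip with
  | some e, some rsn => some { e with dsn := rsn, flag := .inv }
  | r, _ => r

open Classical in
/-- The destinations with a valid route via the next hop `nh`, with their incremented sequence
numbers. -/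
noncomputable def brokenDests (rt : RT IP) (nh : IP) : Dests IP := fun rip =>
  if rip ∈ vD rt ∧ nhop rt rip = some nh then some (inc (sqn rt rip)) else none

open Classical in
/-- Those destinations reported by the neighbour `sip` as unreachable that this node reaches via
`sip`, provided that the reported sequence number is larger than the stored one. -/
noncomputable def affectedDests (rt : RT IP) (dests : Dests IP) (sip : IP) : Dests IP := fun rip =>
  match dests rip with
  | some rsn =>
      if rip ∈ vD rt ∧ nhop rt rip = some sip ∧ sqn rt rip < rsn then some rsn else none
  | none => none

/-- The union of the precursor sets of the given destinations. -/
def allPrecs (rt : RT IP) (dests : Dests IP) : Set IP :=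
  {ip | ∃ rip pre, dests rip ≠ none ∧ precs rt rip = some pre ∧ ip ∈ pre}

open Classical in
/-- Those of the given destinations that have precursors. -/
noncomputable def withPrecs (rt : RT IP) (dests : Dests IP) : Dests IP := fun rip =>
  if ∃ pre, precs rt rip = some pre ∧ pre ≠ ∅ then dests rip else none

open Classical in
/-- The set with the single destination `dip` and its sequence number. -/
noncomputable def singleDest (dip : IP) (n : ℕ) : Dests IP := fun rip =>
  if rip = dip then some n else none

/-- A fresh request identifier for the originator `ip`. -/
noncomputable def nrreqid (rreqs : Set (IP × ℕ)) (ip : IP) : ℕ := sSup {n | (ip, n) ∈ rreqs} + 1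

/-- The destinations for which packets are queued. -/
def qD (queues : Queues IP DATA) : Set IP := {dip | queues dip ≠ none}

open Classical in
/-- Queue a packet for `dip`; a new queue starts without a pending request. -/
noncomputable def addPkt (d : DATA) (dip : IP) (queues : Queues IP DATA) : Queues IP DATA :=
  Function.update queues dip <| some <|
    match queues dip with
    | none => (.nonpen, [d])
    | some (f, l) => (f, l ++ [d])

open Classical in
/-- Remove the first packet for `dip`, and the queue with it if no packet is left. -/
noncomputable def dropPkt (dip : IP) (queues : Queues IP DATA) : Queues IP DATA :=
  Function.update queues dip <|
    match queues dip with
    | some (f, _ :: d :: l) => some (f, d :: l)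
    | _ => none

/-- The first packet queued for `dip`. -/
def headPkt (queues : Queues IP DATA) (dip : IP) : Option DATA :=
  (queues dip).bind fun e => e.2.head?

/-- The pending-request flag for `dip`. -/
def pflag (queues : Queues IP DATA) (dip : IP) : Option PFlag := (queues dip).map Prod.fst

open Classical in
/-- Set the pending-request flag for `dip`. -/
noncomputable def setP (queues : Queues IP DATA) (dip : IP) (f : PFlag) : Queues IP DATA :=
  Function.update queues dip ((queues dip).map fun e => (f, e.2))

/-- Record that there is no pending request for any of the given destinations. -/
def clearP (queues : Queues IP DATA) (dests : Dests IP) : Queues IP DATA := fun dip =>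
  match queues dip, dests dip with
  | some e, some _ => some (.nonpen, e.2)
  | q, _ => q

end Operators

/-! # The specification of AODV -/

/-- The data variables. -/
inductive Var : Type
  | ip | dip | oip | sip
  | sn | dsn | osn
  | dsk | hops | rt | rreqid | queues | data | msg | msgs | pre | dests | rreqs
  deriving DecidableEq

/-- The types of the data variables. -/
@[reducible] def Ty (IP DATA : Type) : Var → Type
  | .ip | .dip | .oip | .sip => IP
  | .sn | .dsn | .osn => ℕ
  | .dsk => SqnK
  | .hops => ℕ
  | .rt => RT IP
  | .rreqid => ℕ
  | .queues => Queues IP DATA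
  | .data => DATA
  | .msg => Msg IP DATA
  | .msgs => List (Msg IP DATA)
  | .pre => Set IP
  | .dests => Dests IP
  | .rreqs => Set (IP × ℕ)

/-- The process names. -/
inductive PName : Type
  | aodv | newpkt | pkt | rreq | rrep | rerr | qmsg

abbrev Valn (IP DATA : Type) : Type := AWN.Valuation (Ty IP DATA)

abbrev Exp (IP DATA α : Type) : Type := AWN.Exp (Ty IP DATA) α

abbrev Proc (IP DATA : Type) : Type := AWN.SP Var (Ty IP DATA) IP DATA (Msg IP DATA) PName

abbrev NodeProc (IP DATA : Type) : Type := AWN.PP Var (Ty IP DATA) IP DATA (Msg IP DATA) PName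

abbrev PNet (IP DATA : Type) : Type := AWN.PNet Var (Ty IP DATA) IP DATA (Msg IP DATA) PName

abbrev Network (IP DATA : Type) : Type := AWN.Network Var (Ty IP DATA) IP DATA (Msg IP DATA) PName

section Specification

variable {IP DATA : Type}

/-- A call in which the listed variables are passed as the parameters of the same name. -/
def callWith (X : PName) (xs : List Var) : Proc IP DATA :=
  .call X (xs.map fun x => ⟨x, fun ξ => ξ x⟩)

/-- The variables maintained by every process on a node except the message queue. -/
def baseVars : List Var := [.ip, .rt, .sn, .rreqs, .queues]

/-- `AODV(ip, rt, sn, rreqs, queues)` -/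
def toAODV : Proc IP DATA := callWith .aodv baseVars

/-- `[φ] p`, where `xs` lists the free variables of `φ`. -/
def guard (xs : List Var) (φ : Exp IP DATA Prop) (p : Proc IP DATA) : Proc IP DATA :=
  .guard ⟨xs, φ⟩ p

/-- The tail of each error procedure: invalidate the routes in `dests`, and send a route error
message to the precursors of these routes. -/
noncomputable def reportErrors : Proc IP DATA :=
  .assign .rt (fun ξ => do some (invalidate (← ξ .rt) (← ξ .dests))) <|
  .assign .queues (fun ξ => do some (clearP (← ξ .queues) (← ξ .dests))) <|
  .assign .pre (fun ξ => do some (allPrecs (← ξ .rt) (← ξ .dests))) <|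
  .assign .dests (fun ξ => do some (withPrecs (← ξ .rt) (← ξ .dests))) <|
  .groupcast (fun ξ => ξ .pre) (fun ξ => do some (.rerr (← ξ .dests) (← ξ .ip))) <|
  toAODV

/-- The error procedure after a failed unicast to the next hop towards `dest`. -/
noncomputable def linkBreak (dest : Exp IP DATA IP) : Proc IP DATA :=
  .assign .dests (fun ξ => do
    let rt ← ξ .rt
    some (brokenDests rt (← nhop rt (← dest ξ)))) reportErrors

/-- The expression `nhop(rt, dest)`. -/
def nhopE (dest : Exp IP DATA IP) : Exp IP DATA IP := fun ξ => do nhop (← ξ .rt) (← dest ξ)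

/-- `rt := update(rt, (sip, 0, unk, val, 1, sip, ∅))` -/
noncomputable def updSender (refresh : Bool) (p : Proc IP DATA) : Proc IP DATA :=
  .assign .rt (fun ξ => do
    let sip ← ξ .sip
    some (upd refresh (← ξ .rt) sip ⟨0, .unk, .val, 1, sip, ∅⟩)) p

/-- The main routine. -/
noncomputable def bodyAODV (refresh : Bool) : Proc IP DATA :=
  .choice
    (.receive .msg rfl <|
      .choice
        (guard [.msg, .data, .dip]
          (fun ξ => do some ((← ξ .msg) = .newpkt (← ξ .data) (← ξ .dip))) <|
          callWith .newpkt (.data :: .dip :: baseVars)) <|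
      .choice
        (guard [.msg, .data, .dip, .oip]
          (fun ξ => do some ((← ξ .msg) = .pkt (← ξ .data) (← ξ .dip) (← ξ .oip))) <|
          callWith .pkt (.data :: .dip :: .oip :: baseVars)) <|
      .choice
        (guard [.msg, .hops, .rreqid, .dip, .dsn, .dsk, .oip, .osn, .sip]
          (fun ξ => do some ((← ξ .msg) = .rreq (← ξ .hops) (← ξ .rreqid) (← ξ .dip) (← ξ .dsn)
            (← ξ .dsk) (← ξ .oip) (← ξ .osn) (← ξ .sip))) <|
          updSender refresh <|
          callWith .rreq
            (.hops :: .rreqid :: .dip :: .dsn :: .dsk :: .oip :: .osn :: .sip :: baseVars)) <|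
      .choice
        (guard [.msg, .hops, .dip, .dsn, .oip, .sip]
          (fun ξ => do some ((← ξ .msg) = .rrep (← ξ .hops) (← ξ .dip) (← ξ .dsn) (← ξ .oip)
            (← ξ .sip))) <|
          updSender refresh <|
          callWith .rrep (.hops :: .dip :: .dsn :: .oip :: .sip :: baseVars))
        (guard [.msg, .dests, .sip]
          (fun ξ => do some ((← ξ .msg) = .rerr (← ξ .dests) (← ξ .sip))) <|
          updSender refresh <|
          callWith .rerr (.dests :: .sip :: baseVars))) <|
  .choice
    -- send a queued packet for some destination to which a valid route is known
    (guard [.dip, .queues, .rt]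
      (fun ξ => do some ((← ξ .dip) ∈ qD (← ξ .queues) ∩ vD (← ξ .rt))) <|
      .assign .data (fun ξ => do headPkt (← ξ .queues) (← ξ .dip)) <|
      .unicast (nhopE fun ξ => ξ .dip)
        (fun ξ => do some (.pkt (← ξ .data) (← ξ .dip) (← ξ .ip)))
        (.assign .queues (fun ξ => do some (dropPkt (← ξ .dip) (← ξ .queues))) toAODV)
        (linkBreak fun ξ => ξ .dip))
    -- initiate a route discovery for some destination of queued packets
    (guard [.dip, .queues, .rt]
      (fun ξ => do
        let dip ← ξ .dip
        let queues ← ξ .queues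
        some (dip ∈ qD queues \ vD (← ξ .rt) ∧ pflag queues dip = some .nonpen)) <|
      .assign .queues (fun ξ => do some (setP (← ξ .queues) (← ξ .dip) .pen)) <|
      .assign .sn (fun ξ => do some (inc (← ξ .sn))) <|
      .assign .rreqid (fun ξ => do some (nrreqid (← ξ .rreqs) (← ξ .ip))) <|
      .assign .rreqs (fun ξ => do some ((← ξ .rreqs) ∪ {((← ξ .ip), (← ξ .rreqid))})) <|
      .broadcast (fun ξ => do
        let dip ← ξ .dip
        let rt ← ξ .rt
        let ip ← ξ .ip
        some (.rreq 0 (← ξ .rreqid) dip (sqn rt dip) (sqnf rt dip) ip (← ξ .sn) ip)) <|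
      toAODV)

/-- Handling of a new data packet, submitted by the local client. -/
noncomputable def bodyNewpkt : Proc IP DATA :=
  .choice
    (guard [.dip, .ip] (fun ξ => do some ((← ξ .dip) = (← ξ .ip))) <|
      .deliver (fun ξ => ξ .data) toAODV)
    (guard [.dip, .ip] (fun ξ => do some ((← ξ .dip) ≠ (← ξ .ip))) <|
      .assign .queues (fun ξ => do some (addPkt (← ξ .data) (← ξ .dip) (← ξ .queues))) toAODV)

/-- Handling of a data packet received from another node. -/
noncomputable def bodyPkt : Proc IP DATA :=
  .choice
    (guard [.dip, .ip] (fun ξ => do some ((← ξ .dip) = (← ξ .ip))) <|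
      .deliver (fun ξ => ξ .data) toAODV)
    (guard [.dip, .ip] (fun ξ => do some ((← ξ .dip) ≠ (← ξ .ip))) <|
      .choice
        (guard [.dip, .rt] (fun ξ => do some ((← ξ .dip) ∈ vD (← ξ .rt))) <|
          .unicast (nhopE fun ξ => ξ .dip)
            (fun ξ => do some (.pkt (← ξ .data) (← ξ .dip) (← ξ .oip)))
            toAODV
            (linkBreak fun ξ => ξ .dip))
        (guard [.dip, .rt] (fun ξ => do some ((← ξ .dip) ∉ vD (← ξ .rt))) <|
          .choice
            (guard [.dip, .rt] (fun ξ => do some ((← ξ .dip) ∈ kD (← ξ .rt))) <|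
              .groupcast (fun ξ => do precs (← ξ .rt) (← ξ .dip))
                (fun ξ => do
                  let dip ← ξ .dip
                  some (.rerr (singleDest dip (sqn (← ξ .rt) dip)) (← ξ .ip)))
                toAODV)
            (guard [.dip, .rt] (fun ξ => do some ((← ξ .dip) ∉ kD (← ξ .rt))) toAODV)))

/-- Handling of a route request. -/
noncomputable def bodyRreq (refresh : Bool) : Proc IP DATA :=
  .choice
    (guard [.oip, .rreqid, .rreqs]
      (fun ξ => do some (((← ξ .oip), (← ξ .rreqid)) ∈ (← ξ .rreqs)))
      toAODV)
    (guard [.oip, .rreqid, .rreqs]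
      (fun ξ => do some (((← ξ .oip), (← ξ .rreqid)) ∉ (← ξ .rreqs))) <|
      .assign .rt (fun ξ => do
        some (upd refresh (← ξ .rt) (← ξ .oip)
          ⟨(← ξ .osn), .kno, .val, (← ξ .hops) + 1, (← ξ .sip), ∅⟩)) <|
      .assign .rreqs (fun ξ => do some ((← ξ .rreqs) ∪ {((← ξ .oip), (← ξ .rreqid))})) <|
      .choice
        -- this node is the destination
        (guard [.dip, .ip] (fun ξ => do some ((← ξ .dip) = (← ξ .ip))) <|
          .assign .sn (fun ξ => do some (max (← ξ .sn) (← ξ .dsn))) <|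
          .unicast (nhopE fun ξ => ξ .oip)
            (fun ξ => do some (.rrep 0 (← ξ .dip) (← ξ .sn) (← ξ .oip) (← ξ .ip)))
            toAODV
            (linkBreak fun ξ => ξ .oip))
        (guard [.dip, .ip] (fun ξ => do some ((← ξ .dip) ≠ (← ξ .ip))) <|
          .choice
            -- a valid route to the destination is known that is fresh enough
            (guard [.dip, .dsn, .rt]
              (fun ξ => do
                let dip ← ξ .dip
                let rt ← ξ .rt
                some (dip ∈ vD rt ∧ (← ξ .dsn) ≤ sqn rt dip ∧ sqnf rt dip = .kno)) <|
              .assign .rt (fun ξ => do addpreRT (← ξ .rt) (← ξ .dip) {(← ξ .sip)}) <|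
              .assign .rt (fun ξ => do
                let rt ← ξ .rt
                addpreRT rt (← ξ .oip) {(← nhop rt (← ξ .dip))}) <|
              .unicast (nhopE fun ξ => ξ .oip)
                (fun ξ => do
                  let dip ← ξ .dip
                  let rt ← ξ .rt
                  some (.rrep (← dhops rt dip) dip (sqn rt dip) (← ξ .oip) (← ξ .ip)))
                toAODV
                (linkBreak fun ξ => ξ .oip))
            -- no such route is known; forward the request
            (guard [.dip, .dsn, .rt]
              (fun ξ => do
                let dip ← ξ .dip
                let rt ← ξ .rt
                some (dip ∉ vD rt ∨ sqn rt dip < (← ξ .dsn) ∨ sqnf rt dip = .unk)) <|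
              .broadcast (fun ξ => do
                let dip ← ξ .dip
                some (.rreq ((← ξ .hops) + 1) (← ξ .rreqid) dip (max (sqn (← ξ .rt) dip) (← ξ .dsn))
                  (← ξ .dsk) (← ξ .oip) (← ξ .osn) (← ξ .ip)))
                toAODV)))

/-- The expression `update(rt, (dip, dsn, kno, val, hops + 1, sip, ∅))`. -/
noncomputable def rrepUpd (refresh : Bool) : Exp IP DATA (RT IP) := fun ξ => do
  some (upd refresh (← ξ .rt) (← ξ .dip) ⟨(← ξ .dsn), .kno, .val, (← ξ .hops) + 1, (← ξ .sip), ∅⟩)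

/-- Handling of a route reply. -/
noncomputable def bodyRrep (refresh : Bool) : Proc IP DATA :=
  .choice
    (guard [.rt, .dip, .dsn, .hops, .sip] (fun ξ => do some ((← ξ .rt) ≠ (← rrepUpd refresh ξ))) <|
      .assign .rt (rrepUpd refresh) <|
      .choice
        -- this node is the originator of the corresponding request
        (guard [.oip, .ip] (fun ξ => do some ((← ξ .oip) = (← ξ .ip))) <|
          .assign .queues (fun ξ => do some (setP (← ξ .queues) (← ξ .dip) .nonpen)) toAODV)
        -- it is not, and forwards the reply
        (guard [.oip, .ip] (fun ξ => do some ((← ξ .oip) ≠ (← ξ .ip))) <|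
          .choice
            (guard [.oip, .rt] (fun ξ => do some ((← ξ .oip) ∈ vD (← ξ .rt))) <|
              .assign .rt (fun ξ => do
                let rt ← ξ .rt
                addpreRT rt (← ξ .dip) {(← nhop rt (← ξ .oip))}) <|
              .assign .rt (fun ξ => do
                let rt ← ξ .rt
                addpreRT rt (← nhop rt (← ξ .dip)) {(← nhop rt (← ξ .oip))}) <|
              .unicast (nhopE fun ξ => ξ .oip)
                (fun ξ => do
                  some (.rrep ((← ξ .hops) + 1) (← ξ .dip) (← ξ .dsn) (← ξ .oip) (← ξ .ip)))
                toAODV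
                (linkBreak fun ξ => ξ .oip))
            (guard [.oip, .rt] (fun ξ => do some ((← ξ .oip) ∉ vD (← ξ .rt))) toAODV)))
    (guard [.rt, .dip, .dsn, .hops, .sip] (fun ξ => do some ((← ξ .rt) = (← rrepUpd refresh ξ)))
      toAODV)

/-- Handling of a route error message. -/
noncomputable def bodyRerr : Proc IP DATA :=
  .assign .dests (fun ξ => do some (affectedDests (← ξ .rt) (← ξ .dests) (← ξ .sip))) reportErrors

/-- `receive(msg).QMSG(append(msg, msgs))` -/
def enqueue : Proc IP DATA :=
  .receive .msg rfl <| .call .qmsg [⟨.msgs, fun ξ => do some ((← ξ .msgs) ++ [(← ξ .msg)])⟩]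

/-- The message queue. -/
def bodyQmsg : Proc IP DATA :=
  .choice enqueue <|
    guard [.msgs] (fun ξ => do some ((← ξ .msgs) ≠ [])) <|
      .choice
        (.send (fun ξ => do (← ξ .msgs).head?) <|
          .call .qmsg [⟨.msgs, fun ξ => do some (← ξ .msgs).tail⟩])
        enqueue

/-- The defining equations of the specification. -/
noncomputable def defs (refresh : Bool) : PName → Proc IP DATA
  | .aodv => bodyAODV refresh
  | .newpkt => bodyNewpkt
  | .pkt => bodyPkt
  | .rreq => bodyRreq refresh
  | .rrep => bodyRrep refresh
  | .rerr => bodyRerr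
  | .qmsg => bodyQmsg

/-- The valuation of a node `ip` at the start: its own address, an empty routing table, the
sequence number 1, and empty sets of seen route requests and of stored data packets. -/
def startMain (ip : IP) : Valn IP DATA
  | .ip => some ip
  | .rt => some fun _ => none
  | .sn => some (1 : ℕ)
  | .rreqs => some (∅ : Set (IP × ℕ))
  | .queues => some fun _ => none
  | _ => none

/-- The valuation of the message queue at the start. -/
def startQueue : Valn IP DATA
  | .msgs => some []
  | _ => none

/-- `ξ, AODV(ip, rt, sn, rreqs, queues) ⟨⟨ ζ, QMSG(msgs)` -/
def startNode (ip : IP) : NodeProc IP DATA :=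
  .par (.seq (startMain ip) toAODV) (.seq startQueue (callWith .qmsg [.msgs]))

/-- The partial networks in which all nodes are in their start state and have different
addresses; their ranges are arbitrary. -/
def IsStart : PNet IP DATA → Prop
  | .node ip P _ => P = startNode ip
  | .par M N => IsStart M ∧ IsStart N ∧ Disjoint M.addresses N.addresses

/-- The network expressions that are reachable from a network of AODV nodes. -/
def Reachable (refresh symm : Bool) (N : Network IP DATA) : Prop :=
  ∃ N₀ : Network IP DATA, IsStart N₀.body ∧
    Relation.ReflTransGen (fun N N' => ∃ a, AWN.NetStep (defs refresh) Msg.newpkt symm N a N') N₀ N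

/-- The arcs of the routing graph of `N` for the destination `dip`: the main process of the node
`ip ≠ dip` has in its routing table a valid entry for `dip` with next hop `ip'`. -/
def Arc (N : Network IP DATA) (dip ip ip' : IP) : Prop :=
  ip ≠ dip ∧ ∃ ξ p ζ q R rt e,
    N.body.HasNode ip (.par (.seq ξ p) (.seq ζ q)) R ∧
      ξ .rt = some rt ∧ rt dip = some e ∧ e.flag = .val ∧ e.nhip = ip'

/-- No routing graph of `N` contains a cycle. -/
def LoopFree (N : Network IP DATA) : Prop :=
  ∀ dip ip : IP, ¬ Relation.TransGen (Arc N dip) ip ip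

end Specification

end AODV

namespace AODV

/-! # Quality of routes -/

section Quality

variable {IP : Type}

/-! Along a route to `dip` the quality of the entries should increase strictly at every hop: larger
sequence number or, for equal numbers, smaller hop count. A cycle is then impossible. The difficulty
is that a node knows the quality of its next hop only from a message, possibly an old one, so what
it believes must survive every later change of that neighbour's table, including the loss and the
recovery of the route.

The remedy is the net sequence number: an invalid entry with number `n` counts as `n - 1`.
Invalidation goes along with an increased number, so the net number does not fall; a route that
replaces an invalid entry makes it rise, unless it remains 0. Hence every table only improves
(`RTImproves`). `Beats` is an assertion that survives: it compares hop counts only while the entry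
is valid, because a recovered route must have a strictly larger net number anyway. The exception at
0 is excluded by `1 ≤ n`.

The invariant refers to an assignment `σ` of tables to addresses. If the next hop of an entry is not
`dip` itself, the table of the next hop has at least the same net number and, if the entry is valid,
beats it. Each queued message makes a similar claim about its sender. All of this is monotone in
`σ`, so steps of other nodes do no harm. Entries whose next hop is `dip` carry no such obligation,
since `dip` has no outgoing arc in its own routing graph; therefore a node's own sequence number
need only be positive.

It remains to see that each node changes its table only in `Admissible` ways (`admissible_upd`,
`admissible_invalidate`) and sends only correct messages (`beats_upd`, `offerOK_of_valid`,
`errorOK_withPrecs`). `Safe` expresses this as a precondition computed along the syntax, `safe_defs`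
checks it for the specification, and `Safe.step`, `NodeOK.step` and `NetOK.step` lift it to
networks. -/

/-- Net sequence number of an entry: that of the last valid route it may stand for. -/
def Entry.nsqn (e : Entry IP) : ℕ :=
  match e.flag with
  | .val => e.dsn
  | .inv => e.dsn - 1

/-- Net sequence number of the entry for `dip` (0 if there is none). -/
def nsqn (rt : RT IP) (dip : IP) : ℕ := ((rt dip).map Entry.nsqn).getD 0

/-- The table has an entry for `dip` with net sequence number at least `n`, and if that entry is
valid, it is strictly better than a route with sequence number `n` and hop count `h`. -/
def Beats (rt : RT IP) (dip : IP) (n h : ℕ) : Prop :=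
  1 ≤ n ∧ ∃ e, rt dip = some e ∧ n ≤ e.nsqn ∧ (e.flag = .val → n < e.nsqn ∨ e.hops < h)

theorem Beats.le_nsqn {rt : RT IP} {dip : IP} {n h : ℕ} (hb : Beats rt dip n h) :
    n ≤ nsqn rt dip := by
  obtain ⟨-, e, he, hn, -⟩ := hb
  simpa [nsqn, he] using hn

/-! ### Improvement of routing tables -/

/-- The routes of `rt'` are at least as good as those of `rt`. -/
def RTImproves (rt rt' : RT IP) : Prop :=
  (∀ dip, nsqn rt dip ≤ nsqn rt' dip) ∧ ∀ dip n h, Beats rt dip n h → Beats rt' dip n h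

theorem RTImproves.refl (rt : RT IP) : RTImproves rt rt := ⟨fun _ => le_rfl, fun _ _ _ h => h⟩

theorem RTImproves.trans {rt rt' rt'' : RT IP} (h : RTImproves rt rt') (h' : RTImproves rt' rt'') :
    RTImproves rt rt'' :=
  ⟨fun d => (h.1 d).trans (h'.1 d), fun d n k hb => h'.2 d n k (h.2 d n k hb)⟩

/-- Entrywise criterion for `RTImproves`. -/
def Entry.Improves (s s' : Entry IP) : Prop :=
  s.nsqn ≤ s'.nsqn ∧
    (s'.flag = .val → s.nsqn < s'.nsqn ∨ s'.nsqn = 0 ∨ (s.flag = .val ∧ s'.hops ≤ s.hops))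

theorem Entry.Improves.refl (s : Entry IP) : s.Improves s :=
  ⟨le_rfl, fun h => .inr (.inr ⟨h, le_rfl⟩)⟩

/-- A strict rise of the net number yields the strict alternative in `Beats`; otherwise a valid
entry was valid before and has gained no hops. A net number 0 cannot occur here, because `Beats`
demands `1 ≤ n`. -/
theorem improves_of_entries {rt rt' : RT IP}
    (h : ∀ dip s, rt dip = some s → ∃ s', rt' dip = some s' ∧ s.Improves s') :
    RTImproves rt rt' := by
  refine ⟨fun dip => ?_, fun dip n k ⟨hn, e, he, hle, hv⟩ => ?_⟩
  · cases hs : rt dip with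
    | none => simp [nsqn, hs]
    | some s =>
      obtain ⟨s', hs', hi⟩ := h dip s hs
      simpa [nsqn, hs, hs'] using hi.1
  · obtain ⟨e', he', hi, hi'⟩ := h dip e he
    refine ⟨hn, e', he', hle.trans hi, fun hval => ?_⟩
    rcases hi' hval with h1 | h1 | ⟨h1, h2⟩
    · exact .inl (by omega)
    · omega
    · rcases hv h1 with h3 | h3
      · exact .inl (by omega)
      · exact .inr (by omega)

/-- Comparison of the routing tables of all nodes. -/
def AllImprove (σ σ' : IP → RT IP) : Prop := ∀ ip, RTImproves (σ ip) (σ' ip)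

theorem AllImprove.refl (σ : IP → RT IP) : AllImprove σ σ := fun _ => .refl _

theorem AllImprove.trans {σ σ' σ'' : IP → RT IP} (h : AllImprove σ σ') (h' : AllImprove σ' σ'') :
    AllImprove σ σ'' := fun ip => (h ip).trans (h' ip)

/-! ### Consistency of an entry with the table of its next hop -/

/-- The entry `e` for `dip` is consistent with the routing table of its next hop. -/
def EntryOK (σ : IP → RT IP) (dip : IP) (e : Entry IP) : Prop :=
  1 ≤ e.hops ∧ (e.dsk = .kno → 1 ≤ e.dsn) ∧
    (e.nhip ≠ dip → e.nsqn ≤ nsqn (σ e.nhip) dip ∧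
      (e.flag = .val → Beats (σ e.nhip) dip e.dsn e.hops))

/-- All entries of the routing table of `ip` are consistent. -/
def TableOK (σ : IP → RT IP) (ip : IP) : Prop := ∀ dip e, σ ip dip = some e → EntryOK σ dip e

/-- The entry stays fixed while the tables improve, and both conditions on the next hop bound its
table from below. -/
theorem EntryOK.mono {σ σ' : IP → RT IP} (h : AllImprove σ σ') {dip : IP} {e : Entry IP}
    (he : EntryOK σ dip e) : EntryOK σ' dip e :=
  ⟨he.1, he.2.1, fun hn => ⟨(he.2.2 hn).1.trans ((h _).1 _),
    fun hv => (h _).2 _ _ _ ((he.2.2 hn).2 hv)⟩⟩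

theorem TableOK.mono {σ σ' : IP → RT IP} (h : AllImprove σ σ') {ip : IP} (hip : σ' ip = σ ip)
    (ht : TableOK σ ip) : TableOK σ' ip :=
  fun dip e he => (ht dip e (hip ▸ he)).mono h

open Classical in
/-- The state of all routing tables after `ip` has changed its table to `rt`. -/
noncomputable def setRT (σ : IP → RT IP) (ip : IP) (rt : RT IP) : IP → RT IP :=
  Function.update σ ip rt

@[simp] theorem setRT_self (σ : IP → RT IP) (ip : IP) (rt : RT IP) : setRT σ ip rt ip = rt := by
  simp [setRT]

theorem setRT_of_ne (σ : IP → RT IP) {ip ip' : IP} (rt : RT IP) (h : ip' ≠ ip) :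
    setRT σ ip rt ip' = σ ip' := by
  simp [setRT, h]

/-- The node `ip` may change its routing table to `rt`. -/
def Admissible (σ : IP → RT IP) (ip : IP) (rt : RT IP) : Prop :=
  RTImproves (σ ip) rt ∧ TableOK (setRT σ ip rt) ip

theorem RTImproves.allImprove {σ : IP → RT IP} {ip : IP} {rt : RT IP}
    (h : RTImproves (σ ip) rt) : AllImprove σ (setRT σ ip rt) := by
  intro i
  by_cases hi : i = ip
  · subst hi; simpa using h
  · rw [setRT_of_ne _ _ hi]; exact .refl _

theorem Admissible.allImprove {σ : IP → RT IP} {ip : IP} {rt : RT IP} (h : Admissible σ ip rt) :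
    AllImprove σ (setRT σ ip rt) := h.1.allImprove

theorem Admissible.mono {σ σ' : IP → RT IP} (h : AllImprove σ σ') {ip : IP} {rt : RT IP}
    (hip : σ' ip = σ ip) (ha : Admissible σ ip rt) : Admissible σ' ip rt := by
  refine ⟨hip ▸ ha.1, ha.2.mono (fun i => ?_) (by simp)⟩
  by_cases hi : i = ip
  · subst hi; simpa using .refl _
  · simpa only [setRT_of_ne _ _ hi] using h i

/-- Criterion for an admissible change, in terms of the routing tables before the change. -/
theorem admissible_of_entries {σ : IP → RT IP} {ip : IP} {rt : RT IP}
    (hi : ∀ dip s, σ ip dip = some s → ∃ s', rt dip = some s' ∧ s.Improves s')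
    (hok : ∀ dip e, rt dip = some e → EntryOK σ dip e) : Admissible σ ip rt := by
  have h := improves_of_entries hi
  -- Consistency is checked against the old tables and carried over by monotonicity, which also
  -- covers a next hop equal to `ip`.
  exact ⟨h, fun dip e he => (hok dip e (by simpa using he)).mono h.allImprove⟩

/-! ## Messages -/

/-- What a node with address `sip` claims about its route to `dip` by offering it, with the
sequence number `n` and the hop count `hops`. -/
def OfferOK (σ : IP → RT IP) (hops : ℕ) (dip : IP) (n : ℕ) (sip : IP) : Prop :=
  1 ≤ n ∧ (sip ≠ dip → Beats (σ sip) dip n (hops + 1))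

/-- What a node with address `sip` claims by a route error message. -/
def ErrorOK (σ : IP → RT IP) (dests : Dests IP) (sip : IP) : Prop :=
  ∀ rip rsn, dests rip = some rsn → rsn - 1 ≤ nsqn (σ sip) rip

/-- The claims made by a message are correct. -/
def MsgOK {DATA : Type} (σ : IP → RT IP) : Msg IP DATA → Prop
  | .newpkt _ _ => True
  | .pkt _ _ _ => True
  | .rreq hops _ _ _ _ oip osn sip => OfferOK σ hops oip osn sip
  | .rrep hops dip dsn _ sip => OfferOK σ hops dip dsn sip
  | .rerr dests sip => ErrorOK σ dests sip

theorem OfferOK.mono {σ σ' : IP → RT IP} (h : AllImprove σ σ') {hops n : ℕ} {dip sip : IP}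
    (ho : OfferOK σ hops dip n sip) : OfferOK σ' hops dip n sip :=
  ⟨ho.1, fun hn => (h _).2 _ _ _ (ho.2 hn)⟩

theorem ErrorOK.mono {σ σ' : IP → RT IP} (h : AllImprove σ σ') {dests : Dests IP} {sip : IP}
    (he : ErrorOK σ dests sip) : ErrorOK σ' dests sip :=
  fun rip rsn hr => (he rip rsn hr).trans ((h _).1 _)

/-- Claims are lower bounds on the sender's table, so a message remains correct while it waits in a
queue. -/
theorem MsgOK.mono {DATA : Type} {σ σ' : IP → RT IP} (h : AllImprove σ σ') {m : Msg IP DATA}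
    (hm : MsgOK σ m) : MsgOK σ' m := by
  cases m with
  | newpkt => trivial
  | pkt => trivial
  | rreq => exact OfferOK.mono h hm
  | rrep => exact OfferOK.mono h hm
  | rerr => exact ErrorOK.mono h hm

/-! ## Changes of routing tables -/

theorem Entry.Improves.addpre (e : Entry IP) (A : Set IP) : e.Improves (e.addpre A) :=
  Entry.Improves.refl e

theorem EntryOK.addpre {σ : IP → RT IP} {dip : IP} {e : Entry IP} (h : EntryOK σ dip e)
    (A : Set IP) : EntryOK σ dip (e.addpre A) := h

/-- A larger sequence number, or the same one replacing an invalid entry, raises the net number,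
unless it stays 0; the remaining regular replacement is of a valid entry by one with fewer hops. A
refresh keeps the sequence number, and there `hunk` rules out a longer route. -/
theorem improves_mergeEntry (refresh : Bool) {s r : Entry IP} (hr : r.flag = .val)
    (hunk : r.dsk = .unk → r.hops ≤ s.hops) : s.Improves (mergeEntry refresh s r) := by
  unfold mergeEntry
  split_ifs with h1 h2
  · rcases hs : s.flag <;> simp_all [Entry.Improves, Entry.nsqn, Entry.addpre] <;> omega
  · have := hunk h2.2
    rcases hs : s.flag
    · simp_all [Entry.Improves, Entry.nsqn, Entry.addpre]
    · simp_all [Entry.Improves, Entry.nsqn, Entry.addpre]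
      omega
  · exact .addpre _ _

/-- A refreshed entry inherits a sequence number for which `r` does not vouch. As its status is
unknown and its next hop is the destination, both conditions that involve this number are void. -/
theorem entryOK_mergeEntry (refresh : Bool) {σ : IP → RT IP} {dip : IP} {s r : Entry IP}
    (hs : EntryOK σ dip s) (hr : EntryOK σ dip r) (hunk : r.dsk = .unk → r.nhip = dip) :
    EntryOK σ dip (mergeEntry refresh s r) := by
  unfold mergeEntry
  split_ifs with h1 h2
  · exact hr.addpre _
  · exact ⟨hr.1, fun h => by simp [Entry.addpre, h2.2] at h, fun h => absurd (hunk h2.2) h⟩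
  · exact hs.addpre _

theorem admissible_upd (refresh : Bool) {σ : IP → RT IP} {ip dip : IP} {r : Entry IP}
    (ht : TableOK σ ip) (hval : r.flag = .val) (hr : EntryOK σ dip r)
    (hunk : r.dsk = .unk → r.nhip = dip ∧ r.hops = 1) :
    Admissible σ ip (upd refresh (σ ip) dip r) := by
  refine admissible_of_entries (fun d s hs => ?_) (fun d e he => ?_)
  · by_cases hd : d = dip
    · subst hd
      refine ⟨mergeEntry refresh s r, by simp [upd, hs], improves_mergeEntry _ hval fun h => ?_⟩
      -- Consistent entries have at least one hop, so a refresh with one hop is never longer than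
      -- the entry it replaces.
      rw [(hunk h).2]
      exact (ht _ _ hs).1
    · exact ⟨s, by simp [upd, hd, hs], .refl s⟩
  · by_cases hd : d = dip
    · subst hd
      cases hs : σ ip d with
      | none =>
        obtain rfl : r = e := by simpa [upd, hs] using he
        exact hr
      | some s =>
        obtain rfl : mergeEntry refresh s r = e := by simpa [upd, hs] using he
        exact entryOK_mergeEntry _ (ht _ _ hs) hr fun h => (hunk h).1
    · exact ht d e (by simpa [upd, hd] using he)

theorem admissible_upd_sender (refresh : Bool) {σ : IP → RT IP} {ip : IP} (ht : TableOK σ ip)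
    (sip : IP) : Admissible σ ip (upd refresh (σ ip) sip ⟨0, .unk, .val, 1, sip, ∅⟩) :=
  admissible_upd refresh ht rfl ⟨le_rfl, nofun, fun h => absurd rfl h⟩ fun _ => ⟨rfl, rfl⟩

/-- The hop count in the claim of an offer is already the one that the receiver stores, so the claim
is literally the next-hop condition on the new entry. -/
theorem admissible_upd_offer (refresh : Bool) {σ : IP → RT IP} {ip : IP} (ht : TableOK σ ip)
    {hops n : ℕ} {dip sip : IP} (ho : OfferOK σ hops dip n sip) :
    Admissible σ ip (upd refresh (σ ip) dip ⟨n, .kno, .val, hops + 1, sip, ∅⟩) :=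
  admissible_upd refresh ht rfl
    ⟨by simp, fun _ => ho.1, fun h => ⟨(ho.2 h).le_nsqn, fun _ => ho.2 h⟩⟩ nofun

/-- Needed because a message is forwarded with its own values, even if the table prefers another
route. An entry that is kept has a larger sequence number, or the same one while being valid with no
more hops; if it is invalid, its number is strictly larger, so its net number still reaches `r.dsn`.
The bound `r.hops + 1` accounts for the case that `r` itself is adopted. -/
theorem beats_upd (refresh : Bool) (rt : RT IP) {dip : IP} {r : Entry IP} (hval : r.flag = .val)
    (hkno : r.dsk = .kno) (hn : 1 ≤ r.dsn) :
    Beats (upd refresh rt dip r) dip r.dsn (r.hops + 1) := by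
  classical
  refine ⟨hn, _, by simp only [upd, Function.update_self]; rfl, ?_⟩
  cases rt dip with
  | none => simp [Entry.nsqn, hval]
  | some s =>
    simp only [mergeEntry, hkno]
    split_ifs with h1 h2
    · simp [Entry.nsqn, Entry.addpre, hval]
    · simp at h2
    · rcases hs : s.flag <;> simp_all [Entry.nsqn, Entry.addpre] <;> omega

/-! ### Changes of precursors -/

/-- The tables differ at most in their precursors. -/
def SameRoutes (rt rt' : RT IP) : Prop :=
  ∀ dip, (rt dip = none ∧ rt' dip = none) ∨
    ∃ e A, rt dip = some e ∧ rt' dip = some { e with pre := A }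

theorem sameRoutes_addpreRT {rt rt' : RT IP} {dip : IP} {A : Set IP}
    (h : addpreRT rt dip A = some rt') : SameRoutes rt rt' := by
  obtain ⟨s, hs, rfl⟩ := Option.map_eq_some_iff.1 h
  intro d
  by_cases hd : d = dip
  · subst hd
    exact .inr ⟨s, s.pre ∪ A, hs, by simp [Entry.addpre]⟩
  · cases he : rt d with
    | none => exact .inl ⟨rfl, by simp [hd, he]⟩
    | some e => exact .inr ⟨e, e.pre, rfl, by simp [hd, he]⟩

theorem SameRoutes.admissible {σ : IP → RT IP} {ip : IP} {rt : RT IP}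
    (h : SameRoutes (σ ip) rt) (ht : TableOK σ ip) : Admissible σ ip rt := by
  refine admissible_of_entries (fun d s hs => ?_) (fun d e he => ?_)
  · rcases h d with ⟨h1, -⟩ | ⟨e, A, h1, h2⟩
    · simp [h1] at hs
    · obtain rfl := Option.some.inj (hs.symm.trans h1)
      exact ⟨_, h2, Entry.Improves.refl s⟩
  · rcases h d with ⟨-, h2⟩ | ⟨s, A, h1, h2⟩
    · simp [h2] at he
    · obtain rfl := Option.some.inj (he.symm.trans h2)
      exact ht d s h1

theorem SameRoutes.status_eq {rt rt' : RT IP} (h : SameRoutes rt rt') (dip : IP) :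
    status rt' dip = status rt dip := by
  rcases h dip with ⟨h1, h2⟩ | ⟨e, A, h1, h2⟩ <;> simp [status, h1, h2]

theorem SameRoutes.sqnf_eq {rt rt' : RT IP} (h : SameRoutes rt rt') (dip : IP) :
    sqnf rt' dip = sqnf rt dip := by
  rcases h dip with ⟨h1, h2⟩ | ⟨e, A, h1, h2⟩ <;> simp [sqnf, h1, h2]

/-! ### Invalidation of routes -/

/-- The sequence numbers of `dests` are suitable for invalidating the routes of `ip`. -/
def InvalidatesOK (σ : IP → RT IP) (ip : IP) (dests : Dests IP) : Prop :=
  ∀ rip rsn e, dests rip = some rsn → σ ip rip = some e →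
    e.nsqn ≤ rsn - 1 ∧ (e.dsk = .kno → 1 ≤ rsn) ∧
      (e.nhip ≠ rip → rsn - 1 ≤ nsqn (σ e.nhip) rip)

/-- The net number becomes `rsn - 1`, which is what `InvalidatesOK` bounds from both sides. The next
hop need not beat the entry any more, since the entry is no longer valid. -/
theorem admissible_invalidate {σ : IP → RT IP} {ip : IP} {dests : Dests IP} (ht : TableOK σ ip)
    (hd : InvalidatesOK σ ip dests) : Admissible σ ip (invalidate (σ ip) dests) := by
  refine admissible_of_entries (fun d s hs => ?_) (fun d e he => ?_)
  · cases hr : dests d with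
    | none => exact ⟨s, by simp [invalidate, hs, hr], .refl s⟩
    | some rsn =>
      refine ⟨{ s with dsn := rsn, flag := .inv }, by simp only [invalidate, hs, hr], ?_, fun h => ?_⟩
      · exact (hd _ _ _ hr hs).1
      · simp at h
  · cases hs : σ ip d with
    | none => simp [invalidate, hs] at he
    | some s =>
      cases hr : dests d with
      | none =>
        obtain rfl : s = e := by simpa [invalidate, hs, hr] using he
        exact ht d s hs
      | some rsn =>
        simp only [invalidate, hs, hr, Option.some.injEq] at he
        subst he
        have := hd _ _ _ hr hs
        exact ⟨(ht d s hs).1, this.2.1, fun h => ⟨this.2.2 h, nofun⟩⟩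

/-- The increment and the loss of validity cancel: the net number is unchanged, also at 0, where
`inc` and the truncated subtraction both give 0. -/
theorem invalidatesOK_brokenDests {σ : IP → RT IP} {ip : IP} (ht : TableOK σ ip) (nh : IP) :
    InvalidatesOK σ ip (brokenDests (σ ip) nh) := by
  intro rip rsn e hr he
  unfold brokenDests at hr
  split_ifs at hr with h
  have hv : e.flag = .val := by simpa [vD, status, he] using h.1
  obtain rfl : inc e.dsn = rsn := by simpa [sqn, he] using hr
  obtain ⟨-, hkno, hnext⟩ := ht rip e he
  have hq : e.nsqn = e.dsn := by simp [Entry.nsqn, hv]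
  have hi : inc e.dsn - 1 = e.dsn := by unfold inc; split_ifs <;> omega
  refine ⟨by omega, fun hk => ?_, fun hn => ?_⟩
  · have := hkno hk
    omega
  · rw [hi, ← hq]
    exact (hnext hn).1

/-- The strict test against the stored number keeps the net number from falling, as `e.dsn ≤ rsn -
1`. The upper bound is the claim of the error message, whose sender is the next hop. -/
theorem invalidatesOK_affectedDests {σ : IP → RT IP} {ip sip : IP} {dests : Dests IP}
    (hd : ErrorOK σ dests sip) : InvalidatesOK σ ip (affectedDests (σ ip) dests sip) := by
  intro rip rsn e hr he
  unfold affectedDests at hr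
  cases hs : dests rip with
  | none => simp [hs] at hr
  | some n =>
    simp only [hs] at hr
    split_ifs at hr with h
    obtain rfl : n = rsn := by simpa using hr
    have hv : e.flag = .val := by simpa [vD, status, he] using h.1
    have hn : e.nhip = sip := by simpa [nhop, he] using h.2.1
    have hlt : e.dsn < n := by simpa [sqn, he] using h.2.2
    have hq : e.nsqn = e.dsn := by simp [Entry.nsqn, hv]
    refine ⟨by omega, fun _ => by omega, fun _ => ?_⟩
    rw [hn]
    exact hd _ _ hs

/-! ### Messages that a node may send -/

/-- After the invalidation of routes, a report of those with precursors is correct. -/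
theorem errorOK_withPrecs {σ : IP → RT IP} {ip : IP} {rt : RT IP} {dests : Dests IP}
    (hrt : σ ip = invalidate rt dests) : ErrorOK σ (withPrecs (σ ip) dests) ip := by
  intro rip rsn hr
  unfold withPrecs at hr
  split_ifs at hr with h
  obtain ⟨pre, hp, -⟩ := h
  obtain ⟨e', he', -⟩ := Option.map_eq_some_iff.1 hp
  cases he : rt rip with
  | none => simp [hrt, invalidate, he] at he'
  | some e => simp [nsqn, hrt, invalidate, he, hr, Entry.nsqn]

/-- A report of a single route that is not valid is correct. -/
theorem errorOK_singleDest {σ : IP → RT IP} {ip dip : IP} (h : dip ∉ vD (σ ip)) :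
    ErrorOK σ (singleDest dip (sqn (σ ip) dip)) ip := by
  intro rip rsn hr
  unfold singleDest at hr
  split_ifs at hr with hd
  subst hd
  obtain rfl : sqn (σ ip) rip = rsn := by simpa using hr
  cases he : σ ip rip with
  | none => simp [sqn, he]
  | some e => rcases hf : e.flag <;> simp_all [vD, status, sqn, nsqn, Entry.nsqn]

/-- A node may offer its own valid routes with known sequence numbers. -/
theorem offerOK_of_valid {σ : IP → RT IP} {ip dip : IP} {hops : ℕ} (ht : TableOK σ ip)
    (hv : dip ∈ vD (σ ip)) (hk : sqnf (σ ip) dip = .kno) (hh : dhops (σ ip) dip = some hops) :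
    OfferOK σ hops dip (sqn (σ ip) dip) ip := by
  obtain ⟨e, he, rfl⟩ := Option.map_eq_some_iff.1 hh
  have hval : e.flag = .val := by simpa [vD, status, he] using hv
  have hkno : e.dsk = .kno := by simpa [sqnf, he] using hk
  have hs : sqn (σ ip) dip = e.dsn := by simp [sqn, he]
  have hn := (ht dip e he).2.1 hkno
  rw [hs]
  -- A valid entry beats its own sequence number with one hop more, and an offer claims no more than
  -- that.
  exact ⟨hn, fun _ => ⟨hn, e, he, by simp [Entry.nsqn, hval]⟩⟩

end Quality

/-! # Correctness of the processes -/

section Processes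

variable {IP DATA : Type}

/-- The part of the state of the main process of `ip` on which all processes rely. -/
def Base (ip : IP) (σ : IP → RT IP) (ξ : Valn IP DATA) : Prop :=
  ξ .ip = some ip ∧ ξ .rt = some (σ ip) ∧ (∃ sn : ℕ, ξ .sn = some sn ∧ 1 ≤ sn) ∧ TableOK σ ip

/-- The precondition of a process, for its parameters that stem from a message. -/
def ParamsOK (σ : IP → RT IP) (ξ : Valn IP DATA) : PName → Prop
  | .rreq => ∃ hops oip osn sip, ξ .hops = some hops ∧ ξ .oip = some oip ∧ ξ .osn = some osn ∧
      ξ .sip = some sip ∧ OfferOK σ hops oip osn sip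
  | .rrep => ∃ hops dip dsn sip, ξ .hops = some hops ∧ ξ .dip = some dip ∧ ξ .dsn = some dsn ∧
      ξ .sip = some sip ∧ OfferOK σ hops dip dsn sip
  | .rerr => ∃ dests sip, ξ .dests = some dests ∧ ξ .sip = some sip ∧ ErrorOK σ dests sip
  | .qmsg => False
  | _ => True

/-- The process behaves well up to the next call: it changes the routing table only in admissible
ways, sends only correct messages if it receives only correct ones, and establishes the
preconditions of the processes that it calls. -/
def Safe (ip : IP) : Proc IP DATA → (IP → RT IP) → Valn IP DATA → Prop
  | .call X args, σ, ξ => ∀ ξ', AWN.bindArgs ξ args = some ξ' → Base ip σ ξ' ∧ ParamsOK σ ξ' X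
  | .guard φ p, σ, ξ => ∀ ζ, φ.Extends ξ ζ → Safe ip p σ ζ
  | .assign x e p, σ, ξ => ∀ a, e ξ = some a →
      (x ≠ .rt → Safe ip p σ (Function.update ξ x (some a))) ∧
      (x = .rt → ∃ rt, Function.update ξ x (some a) .rt = some rt ∧ Admissible σ ip rt ∧
        Safe ip p (setRT σ ip rt) (Function.update ξ x (some a)))
  | .choice p q, σ, ξ => Safe ip p σ ξ ∧ Safe ip q σ ξ
  | .broadcast ms p, σ, ξ => (∀ m, ms ξ = some m → MsgOK σ m) ∧ Safe ip p σ ξ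
  | .groupcast _ ms p, σ, ξ => (∀ m, ms ξ = some m → MsgOK σ m) ∧ Safe ip p σ ξ
  | .unicast _ ms p q, σ, ξ =>
      (∀ m, ms ξ = some m → MsgOK σ m) ∧ Safe ip p σ ξ ∧ Safe ip q σ ξ
  | .send _ _, _, _ => False
  | .deliver _ p, σ, ξ => Safe ip p σ ξ
  | .receive x h p, σ, ξ => x = .msg ∧ ∀ σ', AllImprove σ σ' → σ' ip = σ ip →
      ∀ m, MsgOK σ' m → Safe ip p σ' (Function.update ξ x (some (cast h m)))

theorem Base.mono {σ σ' : IP → RT IP} (h : AllImprove σ σ') {ip : IP} (hip : σ' ip = σ ip)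
    {ξ : Valn IP DATA} (hb : Base ip σ ξ) : Base ip σ' ξ :=
  ⟨hb.1, hip ▸ hb.2.1, hb.2.2.1, hb.2.2.2.mono h hip⟩

theorem ParamsOK.mono {σ σ' : IP → RT IP} (h : AllImprove σ σ') {ξ : Valn IP DATA} {X : PName}
    (hp : ParamsOK σ ξ X) : ParamsOK σ' ξ X := by
  cases X with
  | rreq => exact let ⟨_, _, _, _, h1, h2, h3, h4, h5⟩ := hp; ⟨_, _, _, _, h1, h2, h3, h4, h5.mono h⟩
  | rrep => exact let ⟨_, _, _, _, h1, h2, h3, h4, h5⟩ := hp; ⟨_, _, _, _, h1, h2, h3, h4, h5.mono h⟩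
  | rerr => exact let ⟨_, _, h1, h2, h3⟩ := hp; ⟨_, _, h1, h2, h3.mono h⟩
  | _ => exact hp

theorem allImprove_setRT {σ σ' : IP → RT IP} (h : AllImprove σ σ') (ip : IP) (rt : RT IP) :
    AllImprove (setRT σ ip rt) (setRT σ' ip rt) := fun i => by
  by_cases hi : i = ip
  · subst hi; simpa using .refl _
  · simpa only [setRT_of_ne _ _ hi] using h i

/-- Other nodes may act between any two steps of a process. Improvement also makes more messages
correct, which strengthens what must be tolerated on reception; the `receive` clause therefore
quantifies over all later tables. -/
theorem Safe.mono {ip : IP} {p : Proc IP DATA} : ∀ {σ σ' : IP → RT IP} {ξ : Valn IP DATA},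
    AllImprove σ σ' → σ' ip = σ ip → Safe ip p σ ξ → Safe ip p σ' ξ := by
  induction p with
  | call X args =>
    exact fun h hip hs ξ' hξ => ⟨(hs ξ' hξ).1.mono h hip, (hs ξ' hξ).2.mono h⟩
  | guard φ p ih => exact fun h hip hs ζ hζ => ih h hip (hs ζ hζ)
  | assign x e p ih =>
    refine fun h hip hs a ha => ⟨fun hx => ih h hip ((hs a ha).1 hx), fun hx => ?_⟩
    obtain ⟨rt, h1, h2, h3⟩ := (hs a ha).2 hx
    exact ⟨rt, h1, h2.mono h hip, ih (allImprove_setRT h ip rt) (by simp) h3⟩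
  | choice p q ihp ihq => exact fun h hip hs => ⟨ihp h hip hs.1, ihq h hip hs.2⟩
  | broadcast ms p ih => exact fun h hip hs => ⟨fun m hm => (hs.1 m hm).mono h, ih h hip hs.2⟩
  | groupcast D ms p ih => exact fun h hip hs => ⟨fun m hm => (hs.1 m hm).mono h, ih h hip hs.2⟩
  | unicast d ms p q ihp ihq =>
    exact fun h hip hs =>
      ⟨fun m hm => (hs.1 m hm).mono h, ihp h hip hs.2.1, ihq h hip hs.2.2⟩
  | send ms p ih => exact fun _ _ hs => hs
  | deliver d p ih => exact fun h hip hs => ih h hip hs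
  | receive x hx p ih =>
    exact fun h hip hs =>
      ⟨hs.1, fun σ'' h' hip' m hm => hs.2 σ'' (h.trans h') (hip'.trans hip) m hm⟩

/-! ## Rules for `Safe` -/

theorem bindArgs_map {ξ ξ' : Valn IP DATA} {xs : List Var}
    (h : AWN.bindArgs ξ (xs.map fun x => ⟨x, fun ξ => ξ x⟩) = some ξ') :
    ∀ x ∈ xs, ξ' x = ξ x := by
  induction xs generalizing ξ' with
  | nil => simp
  | cons y xs ih =>
    simp only [List.map_cons, AWN.bindArgs, Option.bind_eq_bind, Option.bind_eq_some_iff,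
      Option.some.injEq] at h
    obtain ⟨a, ha, ζ, hζ, rfl⟩ := h
    intro x hx
    by_cases hxy : x = y
    · subst hxy; simp [ha]
    · rw [Function.update_of_ne hxy]
      exact ih hζ x (by simpa [hxy] using hx)

theorem safe_callWith {ip : IP} {σ : IP → RT IP} {ξ : Valn IP DATA} {X : PName} {xs : List Var}
    (hb : Base ip σ ξ) (hxs : ∀ x ∈ baseVars, x ∈ xs)
    (hp : ∀ ξ' : Valn IP DATA, (∀ x ∈ xs, ξ' x = ξ x) → ParamsOK σ ξ' X) :
    Safe ip (callWith X xs) σ ξ := by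
  intro ξ' hξ'
  have h := bindArgs_map hξ'
  refine ⟨⟨?_, ?_, ?_, hb.2.2.2⟩, hp ξ' h⟩
  · rw [h _ (hxs _ (by simp [baseVars]))]; exact hb.1
  · rw [h _ (hxs _ (by simp [baseVars]))]; exact hb.2.1
  · rw [h _ (hxs _ (by simp [baseVars]))]; exact hb.2.2.1

theorem safe_toAODV {ip : IP} {σ : IP → RT IP} {ξ : Valn IP DATA} (hb : Base ip σ ξ) :
    Safe ip toAODV σ ξ :=
  safe_callWith hb (fun _ h => h) fun _ _ => trivial

theorem safe_guard {ip : IP} {σ : IP → RT IP} {ξ : Valn IP DATA} {xs : List Var}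
    {φ : Exp IP DATA Prop} {p : Proc IP DATA} (hb : Base ip σ ξ)
    (h : ∀ ζ : Valn IP DATA, Base ip σ ζ → (∀ x v, ξ x = some v → ζ x = some v) →
      (∃ P, φ ζ = some P ∧ P) → Safe ip p σ ζ) :
    Safe ip (guard xs φ p) σ ξ := by
  intro ζ hζ
  have hx : ∀ x v, ξ x = some v → ζ x = some v := fun x v hv => by
    rw [hζ.1 x (by simp [hv]), hv]
  obtain ⟨sn, hsn, hle⟩ := hb.2.2.1
  exact h ζ ⟨hx _ _ hb.1, hx _ _ hb.2.1, ⟨sn, hx _ _ hsn, hle⟩, hb.2.2.2⟩ hx hζ.2.2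

theorem safe_assign {ip : IP} {σ : IP → RT IP} {ξ : Valn IP DATA} {x : Var}
    {e : Exp IP DATA (Ty IP DATA x)} {p : Proc IP DATA} (hb : Base ip σ ξ)
    (hx : x ≠ .ip ∧ x ≠ .rt ∧ x ≠ .sn)
    (h : ∀ a, e ξ = some a → Base ip σ (Function.update ξ x (some a)) →
      Safe ip p σ (Function.update ξ x (some a))) :
    Safe ip (.assign x e p) σ ξ := by
  refine fun a ha => ⟨fun _ => h a ha ?_, fun h' => absurd h' hx.2.1⟩
  obtain ⟨h1, h2, h3, h4⟩ := hb
  refine ⟨?_, ?_, ?_, h4⟩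
  · rwa [Function.update_of_ne hx.1.symm]
  · rwa [Function.update_of_ne hx.2.1.symm]
  · rwa [Function.update_of_ne hx.2.2.symm]

theorem safe_assign_sn {ip : IP} {σ : IP → RT IP} {ξ : Valn IP DATA} {e : Exp IP DATA ℕ}
    {p : Proc IP DATA} (hb : Base ip σ ξ) (he : ∀ n : ℕ, e ξ = some n → 1 ≤ n)
    (h : ∀ n : ℕ, Base ip σ (Function.update ξ .sn (some n)) →
      Safe ip p σ (Function.update ξ .sn (some n))) :
    Safe ip (.assign .sn e p) σ ξ := by
  refine fun a ha => ⟨fun _ => h a ?_, nofun⟩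
  exact ⟨hb.1, hb.2.1, ⟨a, by simp, he a ha⟩, hb.2.2.2⟩

theorem safe_assign_rt {ip : IP} {σ : IP → RT IP} {ξ : Valn IP DATA} {e : Exp IP DATA (RT IP)}
    {p : Proc IP DATA} (hb : Base ip σ ξ)
    (h : ∀ rt : RT IP, e ξ = some rt → Admissible σ ip rt ∧
      (AllImprove σ (setRT σ ip rt) → Base ip (setRT σ ip rt) (Function.update ξ .rt (some rt)) →
        Safe ip p (setRT σ ip rt) (Function.update ξ .rt (some rt)))) :
    Safe ip (.assign .rt e p) σ ξ := by
  refine fun rt ha => ⟨fun h => absurd rfl h, fun _ => ⟨rt, by simp, (h rt ha).1, ?_⟩⟩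
  exact (h rt ha).2 (h rt ha).1.allImprove ⟨hb.1, by simp, hb.2.2.1, (h rt ha).1.2⟩

theorem safe_assign_addpre {ip : IP} {σ : IP → RT IP} {ξ : Valn IP DATA}
    {e : Exp IP DATA (RT IP)} {p : Proc IP DATA} (hb : Base ip σ ξ)
    (he : ∀ rt, e ξ = some rt → ∃ dip A, addpreRT (σ ip) dip A = some rt)
    (h : ∀ rt : RT IP, SameRoutes (σ ip) rt → AllImprove σ (setRT σ ip rt) →
      Base ip (setRT σ ip rt) (Function.update ξ .rt (some rt)) →
        Safe ip p (setRT σ ip rt) (Function.update ξ .rt (some rt))) :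
    Safe ip (.assign .rt e p) σ ξ := by
  refine safe_assign_rt hb fun rt hrt => ?_
  obtain ⟨dip, A, hA⟩ := he rt hrt
  have hs := sameRoutes_addpreRT hA
  exact ⟨hs.admissible hb.2.2.2, h rt hs⟩

/-! ## The processes -/

/-- The sequence numbers are justified when the routes are invalidated. The report is then correct
because it agrees with the table just written, which no other node can change. -/
theorem safe_reportErrors {ip : IP} {σ : IP → RT IP} {ξ : Valn IP DATA} (hb : Base ip σ ξ)
    (hd : ∀ dests, ξ .dests = some dests → InvalidatesOK σ ip dests) :
    Safe ip reportErrors σ ξ := by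
  refine safe_assign_rt hb fun rt' h => ?_
  simp only [hb.2.1, Option.bind_eq_bind, Option.bind_some, Option.bind_eq_some_iff,
    Option.some.injEq] at h
  obtain ⟨dests, hdests, rfl⟩ := h
  refine ⟨admissible_invalidate hb.2.2.2 (hd _ hdests), fun _ hb1 => ?_⟩
  refine safe_assign hb1 (by simp) fun queues _ hb2 => ?_
  refine safe_assign hb2 (by simp) fun pre _ hb3 => ?_
  refine safe_assign hb3 (by simp) fun dests' h hb4 => ?_
  refine ⟨fun m hm => ?_, safe_toAODV hb4⟩
  simp only [hb3.2.1, Option.bind_eq_bind, Option.bind_some, Option.bind_eq_some_iff,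
    Option.some.injEq] at h
  obtain ⟨dests'', hdests'', rfl⟩ := h
  obtain rfl : dests = dests'' := by simpa [hdests] using hdests''
  simp only [hb4.1, Option.bind_eq_bind, Option.bind_some, Function.update_self,
    Option.some.injEq] at hm
  subst hm
  exact errorOK_withPrecs (rt := σ ip) (by simp)

theorem safe_linkBreak {ip : IP} {σ : IP → RT IP} {ξ : Valn IP DATA} (hb : Base ip σ ξ)
    (dest : Exp IP DATA IP) : Safe ip (linkBreak dest) σ ξ := by
  refine safe_assign hb (by simp) fun dests h hb1 => safe_reportErrors hb1 fun dests' hd => ?_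
  obtain rfl : dests = dests' := by simpa using hd
  simp only [hb.2.1, Option.bind_eq_bind, Option.bind_some, Option.bind_eq_some_iff,
    Option.some.injEq] at h
  obtain ⟨d, -, nh, -, rfl⟩ := h
  exact invalidatesOK_brokenDests hb.2.2.2 nh

theorem safe_updSender (refresh : Bool) {ip : IP} {σ : IP → RT IP} {ξ : Valn IP DATA}
    {p : Proc IP DATA} (hb : Base ip σ ξ)
    (h : ∀ rt : RT IP, AllImprove σ (setRT σ ip rt) →
      Base ip (setRT σ ip rt) (Function.update ξ .rt (some rt)) →
        Safe ip p (setRT σ ip rt) (Function.update ξ .rt (some rt))) :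
    Safe ip (updSender refresh p) σ ξ := by
  refine safe_assign_rt hb fun rt' he => ⟨?_, h rt'⟩
  simp only [hb.2.1, Option.bind_eq_bind, Option.bind_some, Option.bind_eq_some_iff,
    Option.some.injEq] at he
  obtain ⟨sip, -, rfl⟩ := he
  exact admissible_upd_sender refresh hb.2.2.2 sip

theorem safe_bodyNewpkt {ip : IP} {σ : IP → RT IP} {ξ : Valn IP DATA} (hb : Base ip σ ξ) :
    Safe ip bodyNewpkt σ ξ :=
  ⟨safe_guard hb fun _ hb1 _ _ => safe_toAODV hb1,
    safe_guard hb fun _ hb1 _ _ => safe_assign hb1 (by simp) fun _ _ hb2 => safe_toAODV hb2⟩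

theorem safe_bodyPkt {ip : IP} {σ : IP → RT IP} {ξ : Valn IP DATA} (hb : Base ip σ ξ) :
    Safe ip bodyPkt σ ξ := by
  refine ⟨safe_guard hb fun _ hb1 _ _ => safe_toAODV hb1, safe_guard hb fun _ hb1 _ _ =>
    ⟨safe_guard hb1 fun ζ hb2 _ _ => ⟨fun m hm => ?_, safe_toAODV hb2, safe_linkBreak hb2 _⟩,
      safe_guard hb1 fun ζ hb2 _ hv => ⟨safe_guard hb2 fun ξ' hb3 hx _ =>
        ⟨fun m hm => ?_, safe_toAODV hb3⟩, safe_guard hb2 fun _ hb3 _ _ => safe_toAODV hb3⟩⟩⟩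
  · simp only [Option.bind_eq_bind, Option.bind_eq_some_iff, Option.some.injEq] at hm
    obtain ⟨_, -, _, -, _, -, rfl⟩ := hm
    trivial
  · simp only [hb2.2.1, Option.bind_eq_bind, Option.bind_some, Option.bind_eq_some_iff,
      Option.some.injEq] at hv
    obtain ⟨P, ⟨dip, hdip, rfl⟩, hv⟩ := hv
    simp only [hb3.1, hb3.2.1, hx _ _ hdip, Option.bind_eq_bind, Option.bind_some,
      Option.some.injEq] at hm
    subst hm
    exact errorOK_singleDest hv

theorem safe_bodyRerr {ip : IP} {σ : IP → RT IP} {ξ : Valn IP DATA} (hb : Base ip σ ξ)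
    (hp : ParamsOK σ ξ .rerr) : Safe ip bodyRerr σ ξ := by
  obtain ⟨d, sip, hd, hsip, hok⟩ := hp
  refine safe_assign hb (by simp) fun dests h hb1 => safe_reportErrors hb1 fun dests' hd' => ?_
  obtain rfl : dests = dests' := by simpa using hd'
  simp only [hb.2.1, hd, hsip, Option.bind_eq_bind, Option.bind_some, Option.some.injEq] at h
  subst h
  exact invalidatesOK_affectedDests hok

/-- The forwarded reply repeats the values received, not those stored. It is correct since the
updated table beats this offer, and added precursors preserve that. -/
theorem safe_bodyRrep (refresh : Bool) {ip : IP} {σ : IP → RT IP} {ξ : Valn IP DATA}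
    (hb : Base ip σ ξ) (hp : ParamsOK σ ξ .rrep) : Safe ip (bodyRrep refresh) σ ξ := by
  obtain ⟨hops, dip, dsn, sip, hhops, hdip, hdsn, hsip, hok⟩ := hp
  refine ⟨safe_guard hb fun ζ hb1 hx1 hg => ?_, safe_guard hb fun _ hb1 _ _ => safe_toAODV hb1⟩
  refine safe_assign_rt hb1 fun rt h => ?_
  simp only [rrepUpd, hb1.2.1, hx1 _ _ hhops, hx1 _ _ hdip, hx1 _ _ hdsn, hx1 _ _ hsip,
    Option.bind_eq_bind, Option.bind_some, Option.some.injEq] at h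
  subst h
  refine ⟨admissible_upd_offer refresh hb1.2.2.2 hok, fun hi hb2 => ?_⟩
  have hbeats := beats_upd refresh (σ ip) (dip := dip) (r := ⟨dsn, .kno, .val, hops + 1, sip, ∅⟩)
    rfl rfl hok.1
  refine ⟨safe_guard hb2 fun _ hb3 _ _ => safe_assign hb3 (by simp) fun _ _ hb4 => safe_toAODV hb4,
    safe_guard hb2 fun ξ3 hb3 hx3 _ => ⟨safe_guard hb3 fun ξ4 hb4 hx4 _ => ?_,
      safe_guard hb3 fun _ hb4 _ _ => safe_toAODV hb4⟩⟩
  have hhops4 : ξ4 .hops = some hops := hx4 _ _ (hx3 _ _ (by simpa using hx1 _ _ hhops))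
  have hdip4 : ξ4 .dip = some dip := hx4 _ _ (hx3 _ _ (by simpa using hx1 _ _ hdip))
  have hdsn4 : ξ4 .dsn = some dsn := hx4 _ _ (hx3 _ _ (by simpa using hx1 _ _ hdsn))
  refine safe_assign_addpre hb4 (fun rt5 h5 => ?_) fun rt5 _ hi5 hb5 => ?_
  · simp only [hb4.2.1, Option.bind_eq_bind, Option.bind_some, Option.bind_eq_some_iff] at h5
    obtain ⟨d, -, _, -, _, -, h5⟩ := h5
    exact ⟨d, _, h5⟩
  refine safe_assign_addpre hb5 (fun rt6 h6 => ?_) fun rt6 _ hi6 hb6 => ?_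
  · simp only [hb5.2.1, Option.bind_eq_bind, Option.bind_some, Option.bind_eq_some_iff] at h6
    obtain ⟨d, -, _, -, _, -, _, -, h6⟩ := h6
    exact ⟨_, _, h6⟩
  refine ⟨fun m hm => ?_, safe_toAODV hb6, safe_linkBreak hb6 _⟩
  simp [hhops4, hdip4, hdsn4, hb4.1, Option.bind_eq_some_iff] at hm
  obtain ⟨oip, -, rfl⟩ := hm
  exact ⟨hok.1, fun _ => (hi6 ip).2 _ _ _ <| (hi5 ip).2 _ _ _ <| by simpa using hbeats⟩

/-- The three outgoing messages rest on different grounds. The destination offers itself and needs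
only a positive sequence number; an intermediate reply offers a valid entry with known number; a
forwarded request offers a route to `oip`, not to `dip`, and is justified by `beats_upd`. -/
theorem safe_bodyRreq (refresh : Bool) {ip : IP} {σ : IP → RT IP} {ξ : Valn IP DATA}
    (hb : Base ip σ ξ) (hp : ParamsOK σ ξ .rreq) : Safe ip (bodyRreq refresh) σ ξ := by
  obtain ⟨hops, oip, osn, sip, hhops, hoip, hosn, hsip, hok⟩ := hp
  refine ⟨safe_guard hb fun _ hb1 _ _ => safe_toAODV hb1, safe_guard hb fun ζ hb1 hx1 hg => ?_⟩
  refine safe_assign_rt hb1 fun rt h => ?_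
  simp only [hb1.2.1, hx1 _ _ hhops, hx1 _ _ hoip, hx1 _ _ hosn, hx1 _ _ hsip,
    Option.bind_eq_bind, Option.bind_some, Option.some.injEq] at h
  subst h
  refine ⟨admissible_upd_offer refresh hb1.2.2.2 hok, fun hi hb2 => ?_⟩
  have hbeats := beats_upd refresh (σ ip) (dip := oip) (r := ⟨osn, .kno, .val, hops + 1, sip, ∅⟩)
    rfl rfl hok.1
  refine safe_assign hb2 (by simp) fun rreqs _ hb3 => ?_
  refine ⟨safe_guard hb3 fun ξ4 hb4 _ hg => ?_, safe_guard hb3 fun ξ4 hb4 hx4 _ =>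
    ⟨safe_guard hb4 fun ξ5 hb5 _ hg => ?_, safe_guard hb4 fun ξ5 hb5 hx5 _ => ?_⟩⟩
  · refine safe_assign_sn hb4 (fun n hn => ?_) fun n hb5 =>
      ⟨fun m hm => ?_, safe_toAODV hb5, safe_linkBreak hb5 _⟩
    · obtain ⟨sn, hsn, hle⟩ := hb4.2.2.1
      simp only [hsn, Option.bind_eq_bind, Option.bind_some, Option.bind_eq_some_iff,
        Option.some.injEq] at hn
      obtain ⟨dsn, -, rfl⟩ := hn
      exact hle.trans (le_max_left _ _)
    · obtain ⟨sn, hsn, hle⟩ := hb5.2.2.1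
      simp only [hb4.1, Option.bind_eq_bind, Option.bind_some, Option.bind_eq_some_iff,
        Option.some.injEq] at hg
      obtain ⟨P, ⟨dip, hdip, rfl⟩, hg⟩ := hg
      subst hg
      simp only [hsn, hb5.1, Option.bind_eq_bind, Option.bind_some, Option.bind_eq_some_iff,
        Option.some.injEq] at hm
      obtain ⟨dip', hdip', oip, -, rfl⟩ := hm
      obtain rfl : dip = dip' := by simpa [hdip] using hdip'
      exact ⟨hle, fun h => absurd rfl h⟩
  · simp only [hb5.2.1, Option.bind_eq_bind, Option.bind_some, Option.bind_eq_some_iff,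
      Option.some.injEq] at hg
    obtain ⟨P, ⟨dip, hdip, _, -, rfl⟩, hv, -, hk⟩ := hg
    refine safe_assign_addpre hb5 (fun rt6 h6 => ?_) fun rt6 hs6 _ hb6 => ?_
    · simp only [hb5.2.1, Option.bind_eq_bind, Option.bind_some, Option.bind_eq_some_iff] at h6
      obtain ⟨d, -, _, -, h6⟩ := h6
      exact ⟨d, _, h6⟩
    refine safe_assign_addpre hb6 (fun rt7 h7 => ?_) fun rt7 hs7 _ hb7 => ?_
    · simp only [hb6.2.1, Option.bind_eq_bind, Option.bind_some, Option.bind_eq_some_iff] at h7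
      obtain ⟨d, -, _, -, _, -, h7⟩ := h7
      exact ⟨d, _, h7⟩
    refine ⟨fun m hm => ?_, safe_toAODV hb7, safe_linkBreak hb7 _⟩
    simp only [hb7.1, hb7.2.1, Option.bind_eq_bind, Option.bind_some, Option.bind_eq_some_iff,
      Option.some.injEq] at hm
    obtain ⟨dip', hdip', hops', hh, oip', -, rfl⟩ := hm
    obtain rfl : dip = dip' := by simpa [hdip] using hdip'
    rw [setRT_self] at hs7
    -- The added precursors leave the validity and the status as they were when tested.
    refine offerOK_of_valid hb7.2.2.2 ?_ ?_ hh
    · rw [setRT_self]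
      exact (hs7.status_eq _).trans ((hs6.status_eq _).trans hv)
    · rw [setRT_self]
      exact (hs7.sqnf_eq _).trans ((hs6.sqnf_eq _).trans hk)
  · refine ⟨fun m hm => ?_, safe_toAODV hb5⟩
    have hhops5 : ξ5 .hops = some hops := hx5 _ _ (hx4 _ _ (by simpa using hx1 _ _ hhops))
    have hoip5 : ξ5 .oip = some oip := hx5 _ _ (hx4 _ _ (by simpa using hx1 _ _ hoip))
    have hosn5 : ξ5 .osn = some osn := hx5 _ _ (hx4 _ _ (by simpa using hx1 _ _ hosn))
    simp only [hhops5, hoip5, hosn5, hb5.1, Option.bind_eq_bind, Option.bind_some,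
      Option.bind_eq_some_iff, Option.some.injEq] at hm
    obtain ⟨_, -, _, -, _, -, _, -, _, -, rfl⟩ := hm
    exact ⟨hok.1, fun _ => by simpa using hbeats⟩

theorem safe_bodyAODV (refresh : Bool) {ip : IP} {σ : IP → RT IP} {ξ : Valn IP DATA}
    (hb : Base ip σ ξ) : Safe ip (bodyAODV refresh) σ ξ := by
  refine ⟨⟨rfl, fun σ' h hip m hm => ?_⟩, ?_, ?_⟩
  · replace hb := hb.mono h hip
    have hb1 : Base ip σ' (Function.update ξ .msg (some m)) := hb
    have hmsg : Function.update ξ .msg (some m) .msg = some m := by simp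
    change Safe ip _ σ' (Function.update ξ .msg (some m))
    generalize Function.update ξ .msg (some m) = ξ1 at *
    refine ⟨safe_guard hb1 fun ζ hb2 _ _ => ?_, safe_guard hb1 fun ζ hb2 _ _ => ?_,
      safe_guard hb1 fun ζ hb2 hx hg => ?_, safe_guard hb1 fun ζ hb2 hx hg => ?_,
      safe_guard hb1 fun ζ hb2 hx hg => ?_⟩
    · exact safe_callWith hb2 (by simp [baseVars]) fun _ _ => trivial
    · exact safe_callWith hb2 (by simp [baseVars]) fun _ _ => trivial
    · simp only [hx _ _ hmsg, Option.bind_eq_bind, Option.bind_some, Option.bind_eq_some_iff,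
        Option.some.injEq] at hg
      obtain ⟨P, ⟨hops, h1, _, h2, _, h3, _, h4, _, h5, oip, h6, osn, h7, sip, h8, rfl⟩, hP⟩ := hg
      subst hP
      -- The route to the sender is entered before the call, so the claim of the message is carried
      -- over to the improved tables.
      refine safe_updSender refresh hb2 fun rt hi hb3 => ?_
      refine safe_callWith hb3 (by simp [baseVars]) fun ξ' h' => ?_
      refine ⟨hops, oip, osn, sip, ?_, ?_, ?_, ?_, hm.mono hi⟩ <;> simp [*]
    · simp only [hx _ _ hmsg, Option.bind_eq_bind, Option.bind_some, Option.bind_eq_some_iff,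
        Option.some.injEq] at hg
      obtain ⟨P, ⟨hops, h1, dip, h2, dsn, h3, oip, h4, sip, h5, rfl⟩, hP⟩ := hg
      subst hP
      refine safe_updSender refresh hb2 fun rt hi hb3 => ?_
      refine safe_callWith hb3 (by simp [baseVars]) fun ξ' h' => ?_
      refine ⟨hops, dip, dsn, sip, ?_, ?_, ?_, ?_, hm.mono hi⟩ <;> simp [*]
    · simp only [hx _ _ hmsg, Option.bind_eq_bind, Option.bind_some, Option.bind_eq_some_iff,
        Option.some.injEq] at hg
      obtain ⟨P, ⟨dests, h1, sip, h2, rfl⟩, hP⟩ := hg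
      subst hP
      refine safe_updSender refresh hb2 fun rt hi hb3 => ?_
      refine safe_callWith hb3 (by simp [baseVars]) fun ξ' h' => ?_
      refine ⟨dests, sip, ?_, ?_, hm.mono hi⟩ <;> simp [*]
  · refine safe_guard hb fun ζ hb1 _ _ => safe_assign hb1 (by simp) fun d _ hb2 => ?_
    refine ⟨fun m hm => ?_, safe_assign hb2 (by simp) fun _ _ hb3 => safe_toAODV hb3,
      safe_linkBreak hb2 _⟩
    simp only [Option.bind_eq_bind, Option.bind_eq_some_iff, Option.some.injEq] at hm
    obtain ⟨_, -, _, -, _, -, rfl⟩ := hm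
    trivial
  · refine safe_guard hb fun ζ hb1 _ _ => safe_assign hb1 (by simp) fun _ _ hb2 => ?_
    refine safe_assign_sn hb2 (fun n hn => ?_) fun n hb3 => ?_
    · obtain ⟨sn, hsn, hle⟩ := hb2.2.2.1
      simp only [hsn, Option.bind_eq_bind, Option.bind_some, Option.some.injEq] at hn
      subst hn
      unfold inc
      split_ifs <;> omega
    refine safe_assign hb3 (by simp) fun _ _ hb4 => safe_assign hb4 (by simp) fun _ _ hb5 => ?_
    refine ⟨fun m hm => ?_, safe_toAODV hb5⟩
    obtain ⟨sn, hsn, hle⟩ := hb5.2.2.1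
    simp only [hb5.1, hb5.2.1, hsn, Option.bind_eq_bind, Option.bind_some,
      Option.bind_eq_some_iff, Option.some.injEq] at hm
    obtain ⟨_, -, _, -, rfl⟩ := hm
    exact ⟨hle, fun h => absurd rfl h⟩

theorem safe_defs (refresh : Bool) {ip : IP} {σ : IP → RT IP} {ξ : Valn IP DATA} {X : PName}
    (hb : Base ip σ ξ) (hp : ParamsOK σ ξ X) : Safe ip (defs refresh X) σ ξ := by
  cases X with
  | aodv => exact safe_bodyAODV refresh hb
  | newpkt => exact safe_bodyNewpkt hb
  | pkt => exact safe_bodyPkt hb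
  | rreq => exact safe_bodyRreq refresh hb hp
  | rrep => exact safe_bodyRrep refresh hb hp
  | rerr => exact safe_bodyRerr hb hp
  | qmsg => exact hp.elim

end Processes

/-! # Invariants of networks -/

section Networks

variable {IP DATA : Type}

theorem setRT_eq_self (σ : IP → RT IP) (ip : IP) : setRT σ ip (σ ip) = σ := by
  simp [setRT]

theorem admissible_self {σ : IP → RT IP} {ip : IP} (h : TableOK σ ip) : Admissible σ ip (σ ip) :=
  ⟨.refl _, by rwa [setRT_eq_self]⟩

/-- The action transmits the message `m` to other nodes. -/
def Emits (a : AWN.Act IP DATA (Msg IP DATA)) (m : Msg IP DATA) : Prop :=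
  a = .broadcast m ∨ (∃ D, a = .groupcast D m) ∨ ∃ dip, a = .unicast dip m

/-- What a transition with the label `a` of a process on the node `ip` may do to the routing table
of `ip`. -/
def StepOK (σ : IP → RT IP) (ip : IP) (a : AWN.Act IP DATA (Msg IP DATA)) (rt : RT IP) : Prop :=
  Admissible σ ip rt ∧ (∀ m, Emits a m → MsgOK σ m) ∧ (a ≠ .tau → rt = σ ip)

theorem stepOK_self {σ : IP → RT IP} {ip : IP} {a : AWN.Act IP DATA (Msg IP DATA)}
    (ht : TableOK σ ip) (h : ∀ m, Emits a m → MsgOK σ m) : StepOK σ ip a (σ ip) :=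
  ⟨admissible_self ht, h, fun _ => rfl⟩

/-- Recursion is harmless because `Safe` stops at calls: when a step unfolds a call, `safe_defs`
supplies the safety of the body from the precondition. The other cases read off one clause of
`Safe`. -/
theorem Safe.step {refresh : Bool} {ip : IP} {ξ ζ : Valn IP DATA} {p p' : Proc IP DATA}
    {a : AWN.Act IP DATA (Msg IP DATA)} (h : AWN.SeqStep (defs refresh) ξ p a ζ p')
    {σ : IP → RT IP} (hrt : ξ .rt = some (σ ip)) (ht : TableOK σ ip) (hs : Safe ip p σ ξ)
    (ha : ∀ m, a = .receive m → MsgOK σ m) :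
    ∃ rt, StepOK σ ip a rt ∧ ζ .rt = some rt ∧ Safe ip p' (setRT σ ip rt) ζ := by
  induction h with
  | broadcast hm =>
    refine ⟨σ ip, stepOK_self ht fun m he => ?_, hrt, by rw [setRT_eq_self]; exact hs.2⟩
    obtain rfl : _ = m := by simpa [Emits] using he
    exact hs.1 _ hm
  | groupcast hD hm =>
    refine ⟨σ ip, stepOK_self ht fun m he => ?_, hrt, by rw [setRT_eq_self]; exact hs.2⟩
    obtain rfl : _ = m := by simpa [Emits] using he
    exact hs.1 _ hm
  | unicast hd hm =>
    refine ⟨σ ip, stepOK_self ht fun m he => ?_, hrt, by rw [setRT_eq_self]; exact hs.2.1⟩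
    obtain rfl : _ = m := by simpa [Emits] using he
    exact hs.1 _ hm
  | notUnicast hd =>
    exact ⟨σ ip, stepOK_self ht fun m he => by simp [Emits] at he, hrt,
      by rw [setRT_eq_self]; exact hs.2.2⟩
  | send hm => exact hs.elim
  | deliver hd =>
    exact ⟨σ ip, stepOK_self ht fun m he => by simp [Emits] at he, hrt,
      by rw [setRT_eq_self]; exact hs⟩
  | receive h m =>
    obtain ⟨rfl, hs⟩ := hs
    refine ⟨σ ip, stepOK_self ht fun m he => by simp [Emits] at he, ?_, ?_⟩
    · rwa [Function.update_of_ne (by simp)]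
    · rw [setRT_eq_self]
      exact hs σ (.refl σ) rfl m (ha m rfl)
  | @assign ξ x p e a he =>
    by_cases hx : x = .rt
    · obtain ⟨rt, h1, h2, h3⟩ := (hs a he).2 hx
      exact ⟨rt, ⟨h2, fun m hm => by simp [Emits] at hm, fun h => absurd rfl h⟩, h1, h3⟩
    · refine ⟨σ ip, stepOK_self ht fun m he => by simp [Emits] at he, ?_, ?_⟩
      · rwa [Function.update_of_ne (Ne.symm hx)]
      · rw [setRT_eq_self]
        exact (hs a he).1 hx
  | call hargs h ih =>
    obtain ⟨hb, hp⟩ := hs _ hargs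
    exact ih hb.2.1 (safe_defs refresh hb hp) ha
  | choiceLeft h ih => exact ih hrt hs.1 ha
  | choiceRight h ih => exact ih hrt hs.2 ha
  | guard h =>
    refine ⟨σ ip, stepOK_self ht fun m he => by simp [Emits] at he, ?_, ?_⟩
    · rw [h.1 _ (by simp [hrt]), hrt]
    · rw [setRT_eq_self]
      exact hs _ h

/-! ## The message queue -/

/-- The valuation holds a list of messages that satisfy `OK`. -/
def QueueOK (OK : Msg IP DATA → Prop) (ξ : Valn IP DATA) : Prop :=
  ∃ msgs : List (Msg IP DATA), ξ .msgs = some msgs ∧ ∀ m ∈ msgs, OK m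

/-- The process behaves like a message queue: it receives and sends messages only, and it sends only
messages that satisfy `OK` if it receives only such messages. -/
def QueueSafe : Proc IP DATA → (Msg IP DATA → Prop) → Valn IP DATA → Prop
  | .call X args, OK, ξ => X = .qmsg ∧ ∀ ξ', AWN.bindArgs ξ args = some ξ' → QueueOK OK ξ'
  | .guard φ p, OK, ξ => ∀ ζ, φ.Extends ξ ζ → QueueSafe p OK ζ
  | .choice p q, OK, ξ => QueueSafe p OK ξ ∧ QueueSafe q OK ξ
  | .send ms p, OK, ξ => (∀ m, ms ξ = some m → OK m) ∧ QueueSafe p OK ξ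
  | .receive x h p, OK, ξ => ∀ OK' : Msg IP DATA → Prop, (∀ m, OK m → OK' m) →
      ∀ m, OK' m → QueueSafe p OK' (Function.update ξ x (some (cast h m)))
  | _, _, _ => False

/-- Needed with `MsgOK σ` for `OK` as the tables improve; the `receive` clause is closed under such
growth by definition. -/
theorem QueueSafe.mono {p : Proc IP DATA} : ∀ {OK OK' : Msg IP DATA → Prop} {ξ : Valn IP DATA},
    (∀ m, OK m → OK' m) → QueueSafe p OK ξ → QueueSafe p OK' ξ := by
  induction p with
  | call X args =>
    refine fun h hs => ⟨hs.1, fun ξ' hξ => ?_⟩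
    obtain ⟨msgs, h1, h2⟩ := hs.2 ξ' hξ
    exact ⟨msgs, h1, fun m hm => h m (h2 m hm)⟩
  | guard φ p ih => exact fun h hs ζ hζ => ih h (hs ζ hζ)
  | choice p q ihp ihq => exact fun h hs => ⟨ihp h hs.1, ihq h hs.2⟩
  | send ms p ih => exact fun h hs => ⟨fun m hm => h m (hs.1 m hm), ih h hs.2⟩
  | receive x hx p ih => exact fun h hs OK'' h' m hm => hs OK'' (fun m hm => h' m (h m hm)) m hm
  | _ => exact fun _ hs => hs

theorem queueSafe_enqueue {OK : Msg IP DATA → Prop} {ξ : Valn IP DATA} (h : QueueOK OK ξ) :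
    QueueSafe enqueue OK ξ := by
  obtain ⟨msgs, hmsgs, hok⟩ := h
  refine fun OK' hi m hm => ⟨rfl, fun ξ' hξ' => ?_⟩
  simp [AWN.bindArgs, hmsgs] at hξ'
  subst hξ'
  refine ⟨msgs ++ [m], by simp, fun m' hm' => ?_⟩
  rcases List.mem_append.1 hm' with h | h
  · exact hi _ (hok _ h)
  · rwa [List.mem_singleton.1 h]

theorem queueSafe_bodyQmsg {OK : Msg IP DATA → Prop} {ξ : Valn IP DATA} (h : QueueOK OK ξ) :
    QueueSafe bodyQmsg OK ξ := by
  refine ⟨queueSafe_enqueue h, fun ζ hζ => ?_⟩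
  obtain ⟨msgs, hmsgs, hok⟩ := h
  have hmsgs' : ζ .msgs = some msgs := by rw [hζ.1 _ (by simp [hmsgs]), hmsgs]
  refine ⟨⟨fun m hm => ?_, rfl, fun ξ' hξ' => ?_⟩, queueSafe_enqueue ⟨msgs, hmsgs', hok⟩⟩
  · simp only [hmsgs', Option.bind_eq_bind, Option.bind_some] at hm
    exact hok m (List.mem_of_mem_head? hm)
  · simp [AWN.bindArgs, hmsgs'] at hξ'
    subst hξ'
    exact ⟨msgs.tail, by simp, fun m hm => hok m (List.mem_of_mem_tail hm)⟩

theorem QueueSafe.step {refresh : Bool} {ξ ζ : Valn IP DATA} {p p' : Proc IP DATA}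
    {a : AWN.Act IP DATA (Msg IP DATA)} (h : AWN.SeqStep (defs refresh) ξ p a ζ p')
    {OK : Msg IP DATA → Prop} (hs : QueueSafe p OK ξ) (ha : ∀ m, a = .receive m → OK m) :
    QueueSafe p' OK ζ ∧ (∀ m, ¬ Emits a m) ∧ ∀ m, a = .send m → OK m := by
  induction h with
  | send hm => exact ⟨hs.2, by simp [Emits], by simpa using hs.1 _ hm⟩
  | receive h m => exact ⟨hs OK (fun _ h => h) m (ha m rfl), by simp [Emits], nofun⟩
  | call hargs h ih =>
    obtain ⟨rfl, hs⟩ := hs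
    exact ih (queueSafe_bodyQmsg (hs _ hargs)) ha
  | choiceLeft h ih => exact ih hs.1 ha
  | choiceRight h ih => exact ih hs.2 ha
  | guard h => exact ⟨hs _ h, by simp [Emits], nofun⟩
  | _ => exact hs.elim

/-! ## Nodes -/

/-- The invariant of the processes on the node `ip`. -/
def NodeOK (σ : IP → RT IP) (ip : IP) (P : NodeProc IP DATA) : Prop :=
  ∃ ξ p ζ q, P = .par (.seq ξ p) (.seq ζ q) ∧ ξ .rt = some (σ ip) ∧ TableOK σ ip ∧
    Safe ip p σ ξ ∧ QueueSafe q (MsgOK σ) ζ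

theorem NodeOK.mono {σ σ' : IP → RT IP} (h : AllImprove σ σ') {ip : IP} (hip : σ' ip = σ ip)
    {P : NodeProc IP DATA} (hP : NodeOK σ ip P) : NodeOK σ' ip P := by
  obtain ⟨ξ, p, ζ, q, h1, h2, h3, h4, h5⟩ := hP
  exact ⟨ξ, p, ζ, q, h1, hip ▸ h2, h3.mono h hip, h4.mono h hip, h5.mono fun m hm => hm.mono h⟩

theorem NodeOK.step {refresh : Bool} {σ : IP → RT IP} {ip : IP} {P P' : NodeProc IP DATA}
    {a : AWN.Act IP DATA (Msg IP DATA)} (hP : NodeOK σ ip P)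
    (h : AWN.ParStep (defs refresh) P a P') (ha : ∀ m, a = .receive m → MsgOK σ m) :
    ∃ rt, StepOK σ ip a rt ∧ NodeOK (setRT σ ip rt) ip P' := by
  obtain ⟨ξ, p, ζ, q, rfl, hrt, ht, hp, hq⟩ := hP
  cases h with
  | left h _ =>
    cases h with
    | seq h =>
      obtain ⟨rt, h1, h2, h3⟩ := hp.step h hrt ht ha
      exact ⟨rt, h1, _, _, _, _, rfl, by simpa using h2, h1.1.2, h3,
        hq.mono fun m hm => hm.mono h1.1.allImprove⟩
  | right h hne =>
    cases h with
    | seq h =>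
      obtain ⟨h1, h2, -⟩ := hq.step h ha
      refine ⟨σ ip, stepOK_self ht fun m hm => absurd hm (h2 m), ?_⟩
      rw [setRT_eq_self]
      exact ⟨_, _, _, _, rfl, hrt, ht, hp, h1⟩
  | comm hP hQ =>
    cases hP with
    | seq hP =>
      cases hQ with
      | seq hQ =>
        -- The guarantee of the queue for the message sent discharges the assumption of the main
        -- process. For the latter the step is a reception, not a `τ`, so its table stays the same.
        obtain ⟨h1, -, h3⟩ := hq.step hQ nofun
        obtain ⟨rt, h4, h5, h6⟩ := hp.step hP hrt ht (by simpa using h3)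
        obtain rfl := h4.2.2 nofun
        refine ⟨σ ip, stepOK_self ht fun m he => by simp [Emits] at he, ?_⟩
        rw [setRT_eq_self] at h6 ⊢
        exact ⟨_, _, _, _, rfl, h5, ht, h6, h1⟩

/-! ## Networks -/

/-- The invariant of partial networks. -/
def NetOK (σ : IP → RT IP) : PNet IP DATA → Prop
  | .node ip P _ => NodeOK σ ip P
  | .par M N => NetOK σ M ∧ NetOK σ N ∧ Disjoint M.addresses N.addresses

theorem NetOK.mono {σ σ' : IP → RT IP} (h : AllImprove σ σ') {M : PNet IP DATA}
    (hM : ∀ ip ∈ M.addresses, σ' ip = σ ip) (hok : NetOK σ M) : NetOK σ' M := by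
  induction M with
  | node ip P R => exact NodeOK.mono h (hM ip rfl) hok
  | par M N ihM ihN =>
    exact ⟨ihM (fun ip hip => hM ip (.inl hip)) hok.1, ihN (fun ip hip => hM ip (.inr hip)) hok.2.1,
      hok.2.2⟩

/-- What a transition with the label `a` from `M` to `M'` may do. -/
def NetStepOK (σ : IP → RT IP) (M : PNet IP DATA) (a : AWN.NAct IP DATA (Msg IP DATA))
    (M' : PNet IP DATA) : Prop :=
  M'.addresses = M.addresses ∧ (∀ R m, a = .starcast R m → MsgOK σ m) ∧
    ∃ σ', AllImprove σ σ' ∧ (∀ ip ∉ M.addresses, σ' ip = σ ip) ∧ (a ≠ .tau → σ' = σ) ∧ NetOK σ' M'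

theorem NodeOK.netStepOK {refresh : Bool} {σ : IP → RT IP} {ip : IP} {P P' : NodeProc IP DATA}
    {R : Set IP} {a : AWN.Act IP DATA (Msg IP DATA)} {b : AWN.NAct IP DATA (Msg IP DATA)}
    (hP : NodeOK σ ip P) (h : AWN.ParStep (defs refresh) P a P')
    (ha : ∀ m, a = .receive m → MsgOK σ m) (he : ∀ R m, b = .starcast R m → Emits a m)
    (hb : b ≠ .tau → a ≠ .tau) : NetStepOK σ (.node ip P R) b (.node ip P' R) := by
  obtain ⟨rt, ⟨h1, h2, h3⟩, h4⟩ := hP.step h ha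
  refine ⟨rfl, fun R m hm => h2 m (he R m hm), setRT σ ip rt, h1.allImprove,
    fun i hi => setRT_of_ne σ rt hi, fun hne => ?_, h4⟩
  rw [h3 (hb hne), setRT_eq_self]

theorem netStepOK_self {σ : IP → RT IP} {M M' : PNet IP DATA} {a : AWN.NAct IP DATA (Msg IP DATA)}
    (hadd : M'.addresses = M.addresses) (ha : ∀ R m, a = .starcast R m → MsgOK σ m)
    (h : NetOK σ M') : NetStepOK σ M a M' :=
  ⟨hadd, ha, σ, .refl σ, fun _ _ => rfl, fun _ => rfl, h⟩

theorem NetStepOK.of_ne_tau {σ : IP → RT IP} {M M' : PNet IP DATA}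
    {a : AWN.NAct IP DATA (Msg IP DATA)} (h : NetStepOK σ M a M') (ha : a ≠ .tau) :
    NetOK σ M' := by
  obtain ⟨-, -, σ', -, -, h1, h2⟩ := h
  exact h1 ha ▸ h2

/-- Tables change only in `τ`-steps, so synchronising components both keep `σ`, and no two
assignments have to be reconciled. -/
theorem NetStepOK.par {σ : IP → RT IP} {M M' N N' : PNet IP DATA}
    {a a' b : AWN.NAct IP DATA (Msg IP DATA)} (hM : NetStepOK σ M a M') (hN : NetStepOK σ N a' N')
    (ha : a ≠ .tau) (ha' : a' ≠ .tau) (hd : Disjoint M.addresses N.addresses)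
    (hb : ∀ R m, b = .starcast R m → MsgOK σ m) :
    NetStepOK σ (.par M N) b (.par M' N') := by
  have hadd : (AWN.PNet.par M' N').addresses = (AWN.PNet.par M N).addresses := by
    simp only [AWN.PNet.addresses, hM.1, hN.1]
  refine netStepOK_self hadd hb ⟨hM.of_ne_tau ha, hN.of_ne_tau ha', ?_⟩
  rw [hM.1, hN.1]
  exact hd

/-- Only tables of nodes of `M` may change; as addresses are disjoint, the tables of `N` are fixed,
and its invariant survives by monotonicity. -/
theorem NetStepOK.left {σ : IP → RT IP} {M M' N : PNet IP DATA}
    {a : AWN.NAct IP DATA (Msg IP DATA)} (hM : NetStepOK σ M a M') (hN : NetOK σ N)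
    (hd : Disjoint M.addresses N.addresses) : NetStepOK σ (.par M N) a (.par M' N) := by
  obtain ⟨h1, h2, σ', h3, h4, h5, h6⟩ := hM
  refine ⟨by simp only [AWN.PNet.addresses, h1], h2, σ', h3,
    fun ip hip => h4 ip fun h => hip (.inl h), h5, h6,
    hN.mono h3 fun ip hip => h4 ip fun h => Set.disjoint_left.1 hd h hip, ?_⟩
  rwa [h1]

theorem NetStepOK.swap {σ : IP → RT IP} {M M' N N' : PNet IP DATA}
    {a : AWN.NAct IP DATA (Msg IP DATA)} (h : NetStepOK σ (.par M N) a (.par M' N')) :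
    NetStepOK σ (.par N M) a (.par N' M') := by
  obtain ⟨h1, h2, σ', h3, h4, h5, h6, h7, h8⟩ := h
  refine ⟨?_, h2, σ', h3, fun ip hip => h4 ip fun h => hip h.symm, h5, h7, h6, h8.symm⟩
  simpa only [AWN.PNet.addresses, Set.union_comm] using h1

/-- A rely-guarantee argument: an arrival assumes that the message is correct and a cast guarantees
it. So in a cast the sender is treated before the receivers. -/
theorem NetOK.step {refresh symm : Bool} {M M' : PNet IP DATA}
    {a : AWN.NAct IP DATA (Msg IP DATA)} (h : AWN.PNetStep (defs refresh) symm M a M')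
    {σ : IP → RT IP} (hM : NetOK σ M) (ha : ∀ H K m, a = .arrive H K m → MsgOK σ m) :
    NetStepOK σ M a M' := by
  induction h with
  | broadcast h => exact hM.netStepOK h nofun (by rintro _ _ ⟨⟩; exact .inl rfl) nofun
  | groupcast h => exact hM.netStepOK h nofun (by rintro _ _ ⟨⟩; exact .inr (.inl ⟨_, rfl⟩)) nofun
  | unicast h _ => exact hM.netStepOK h nofun (by rintro _ _ ⟨⟩; exact .inr (.inr ⟨_, rfl⟩)) nofun
  | notUnicast h _ => exact hM.netStepOK h nofun nofun nofun
  | deliver h => exact hM.netStepOK h nofun nofun nofun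
  | receive h => exact hM.netStepOK h (by rintro _ ⟨⟩; exact ha _ _ _ rfl) nofun nofun
  | tau h => exact hM.netStepOK h nofun nofun fun h => absurd rfl h
  | disregard => exact netStepOK_self rfl nofun hM
  | connect => exact netStepOK_self rfl nofun hM
  | disconnect => exact netStepOK_self rfl nofun hM
  | connectSymm _ => exact netStepOK_self rfl nofun hM
  | disconnectSymm _ => exact netStepOK_self rfl nofun hM
  | connectOther _ _ _ => exact netStepOK_self rfl nofun hM
  | disconnectOther _ _ _ => exact netStepOK_self rfl nofun hM
  | castLeft _ _ _ _ ihM ihN =>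
    have h1 := ihM hM.1 nofun
    have hm := h1.2.1 _ _ rfl
    have h2 := ihN hM.2.1 (by rintro _ _ _ ⟨⟩; exact hm)
    exact h1.par h2 nofun nofun hM.2.2 (by rintro _ _ ⟨⟩; exact hm)
  | castRight _ _ _ _ ihM ihN =>
    have h1 := ihM hM.2.1 nofun
    have hm := h1.2.1 _ _ rfl
    have h2 := ihN hM.1 (by rintro _ _ _ ⟨⟩; exact hm)
    exact h2.par h1 nofun nofun hM.2.2 (by rintro _ _ ⟨⟩; exact hm)
  | arrive _ _ ihM ihN =>
    have hm := ha _ _ _ rfl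
    exact (ihM hM.1 (by rintro _ _ _ ⟨⟩; exact hm)).par (ihN hM.2.1 (by rintro _ _ _ ⟨⟩; exact hm))
      nofun nofun hM.2.2 nofun
  | interleaveLeft _ _ ih => exact (ih hM.1 ha).left hM.2.1 hM.2.2
  | interleaveRight _ _ ih => exact ((ih hM.2.1 ha).left hM.1 hM.2.2.symm).swap
  | topology _ _ _ htop ihM ihN =>
    have h1 := ihM hM.1 ha
    exact h1.par (ihN hM.2.1 ha) (by rintro rfl; exact htop) (by rintro rfl; exact htop) hM.2.2 h1.2.1

theorem netOK_of_isStart {M : PNet IP DATA} (h : IsStart M) : NetOK (fun _ _ => none) M := by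
  induction M with
  | node ip P R =>
    have ht : TableOK (fun _ _ => none : IP → RT IP) ip := nofun
    refine ⟨startMain ip, toAODV, startQueue, callWith .qmsg [.msgs], h, rfl, ht,
      safe_toAODV ⟨rfl, rfl, ⟨1, rfl, le_rfl⟩, ht⟩, rfl, fun ξ' hξ' => ⟨[], ?_, nofun⟩⟩
    rw [bindArgs_map hξ' .msgs (by simp)]
    rfl
  | par M N ihM ihN => exact ⟨ihM h.1, ihN h.2.1, h.2.2⟩

theorem netOK_of_reachable {refresh symm : Bool} {N : Network IP DATA}
    (h : Reachable refresh symm N) : ∃ σ, NetOK σ N.body := by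
  obtain ⟨N₀, h0, h⟩ := h
  induction h with
  | refl => exact ⟨_, netOK_of_isStart h0⟩
  | tail _ h ih =>
    obtain ⟨a, h⟩ := h
    obtain ⟨σ, hσ⟩ := ih
    cases h with
    | starcast h =>
      obtain ⟨-, -, σ', -, -, -, h'⟩ := hσ.step h nofun
      exact ⟨σ', h'⟩
    | newpkt h =>
      -- Messages from clients make no claim about routes.
      obtain ⟨-, -, σ', -, -, -, h'⟩ := hσ.step h (by rintro _ _ _ ⟨⟩; trivial)
      exact ⟨σ', h'⟩
    | inherit h ha =>
      obtain ⟨-, -, σ', -, -, -, h'⟩ := hσ.step h (by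
        rintro _ _ _ rfl
        rcases ha with h | h <;> exact h.elim)
      exact ⟨σ', h'⟩

/-! # Loop freedom -/

theorem NetOK.nodeOK {σ : IP → RT IP} {M : PNet IP DATA} {ip : IP} {P : NodeProc IP DATA}
    {R : Set IP} (hM : NetOK σ M) (h : M.HasNode ip P R) : NodeOK σ ip P := by
  induction M with
  | node ip' P' R' =>
    obtain ⟨rfl, rfl, rfl⟩ := h
    exact hM
  | par M N ihM ihN => exact h.elim (ihM hM.1) (ihN hM.2.1)

theorem NetOK.entry_of_arc {σ : IP → RT IP} {N : Network IP DATA} (hN : NetOK σ N.body)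
    {dip ip ip' : IP} (h : Arc N dip ip ip') :
    ∃ e, σ ip dip = some e ∧ e.flag = .val ∧ e.nhip = ip' ∧ EntryOK σ dip e := by
  obtain ⟨-, ξ, p, ζ, q, R, rt, e, hnode, hrt, he, hval, hnh⟩ := h
  obtain ⟨ξ', p', ζ', q', heq, hrt', ht, -⟩ := hN.nodeOK hnode
  cases heq
  obtain rfl : rt = σ ip := by simpa [hrt] using hrt'
  exact ⟨e, he, hval, hnh, ht dip e he⟩

/-! ### Strict increase of quality along arcs -/

/-- The quality of the route to `dip` in a routing table. -/
def quality (rt : RT IP) (dip : IP) : ℕ ×ₗ ℕᵒᵈ :=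
  toLex (sqn rt dip, OrderDual.toDual ((dhops rt dip).getD 0))

/-- The second arc shows that `ip'` is not `dip` and has a valid entry. So `Beats` applies with its
strict alternative, and the net number of that entry is its sequence number. -/
theorem NetOK.quality_lt {σ : IP → RT IP} {N : Network IP DATA} (hN : NetOK σ N.body)
    {dip ip ip' ip'' : IP} (h : Arc N dip ip ip') (h' : Arc N dip ip' ip'') :
    quality (σ ip) dip < quality (σ ip') dip := by
  obtain ⟨e, he, hval, rfl, hok⟩ := hN.entry_of_arc h
  obtain ⟨e', he', hval', -, -⟩ := hN.entry_of_arc h'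
  obtain ⟨-, e'', he'', hle, hlt⟩ := (hok.2.2 h'.1).2 hval
  obtain rfl : e' = e'' := by simpa [he'] using he''
  have hq : e'.nsqn = e'.dsn := by simp [Entry.nsqn, hval']
  rw [hq] at hle hlt
  simp only [quality, sqn, dhops, he, he', Option.map_some, Option.getD_some, Prod.Lex.toLex_lt_toLex,
    OrderDual.toDual_lt_toDual]
  rcases hlt hval' with h1 | h1
  · exact .inl h1
  · rcases hle.lt_or_eq with h2 | h2
    · exact .inl h2
    · exact .inr ⟨h2, h1⟩

theorem NetOK.loopFree {σ : IP → RT IP} {N : Network IP DATA} (hN : NetOK σ N.body) :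
    LoopFree N := by
  intro dip ip hcycle
  -- The endpoint must have an outgoing arc itself, as nothing is known about the table of `dip`; on
  -- a cycle the first arc provides one.
  have key : ∀ x y z, Relation.TransGen (Arc N dip) x y → Arc N dip y z →
      quality (σ x) dip < quality (σ y) dip := by
    intro x y z hxy hyz
    induction hxy using Relation.TransGen.head_induction_on with
    | single h => exact hN.quality_lt h hyz
    | head h hpath ih =>
      obtain ⟨w, hw, -⟩ := Relation.TransGen.head'_iff.1 hpath
      exact (hN.quality_lt h hw).trans ih
  obtain ⟨w, hw, -⟩ := Relation.TransGen.head'_iff.1 hcycle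
  exact lt_irrefl _ (key ip ip w hcycle hw)

end Networks

end AODV

theorem mainTheorem5 (IP DATA : Type) (refresh symm : Bool) (N : AODV.Network IP DATA)
    (hN : AODV.Reachable refresh symm N) : AODV.LoopFree N := by
  obtain ⟨σ, hσ⟩ := AODV.netOK_of_reachable hN
  exact hσ.loopFree
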